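/- Let $g\ge 0$ and $p\ge 1$ be integers with $2g+p>2$, let $S=S_{g,p}$ be the oriented surface of genus $g$ with $p$ punctures, and let $$\pi_1(S)=\Big\langle a_1,b_1,\dots,a_g,b_g,c_1,\dots,c_p \ \Big|\ \prod_{i=1}^g[a_i,b_i]=\prod_{j=1}^p c_j\Big\rangle ,$$ where $c_1,\dots,c_p$ are loops around the punctures. Let $\phi$ be an automorphism of $\pi_1(S)$ induced by an orientation-preserving homeomorphism of $S$, that is, an automorphism for which there is a permutation $\sigma$ of $\{1,\dots,p\}$ such that $\phi(c_j)$ is conjugate to $c_{\sigma(j)}$ for every $j$. Let $\phi^*$ be the induced map $u\mapsto u\circ\phi$ on $H^1(S;\mathbb C)=\operatorname{Hom}(\pi_1(S),\mathbb C)$, and let $$\Gamma_\phi=\pi_1(M_\phi)=\pi_1(S)\rtimes_\phi\mathbb Z=\langle \pi_1(S),\tau \mid \tau\gamma\tau^{-1}=\phi(\gamma)\ \text{ for } \gamma\in\pi_1(S)\rangle$$ be the fundamental group of the mapping torus $M_\phi$ of $\phi$. Let $\lambda\in\mathbb C^*$ be such that $\lambda^2$ is an eigenvalue of $\phi^*$,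 let $u\in H^1(S;\mathbb C)$ be an eigenvector with $\phi^*u=\lambda^2u$, and let $\rho_\lambda:\Gamma_\phi\to\operatorname{SL}(2,\mathbb C)$ be the representation with $$\rho_\lambda(\gamma)=\begin{pmatrix}1&u(\gamma)\\0&1\end{pmatrix}\ (\gamma\in\pi_1(S)),\qquad \rho_\lambda(\tau)=\begin{pmatrix}\lambda&0\\0&\lambda^{-1}\end{pmatrix}.$$ For $m\ge 0$ let $R_m$ be the space of homogeneous polynomials of degree $m$ in $\mathbb C[X,Y]$, on which $\begin{pmatrix}a&b\\c&d\end{pmatrix}\in\operatorname{SL}(2,\mathbb C)$ acts by the substitution $X\mapsto dX-bY$, $Y\mapsto -cX+aY$; it is a $\Gamma_\phi$-module through $\rho_\lambda$. Let $n>3$, and suppose that $\lambda^{n-1}$ is not an eigenvalue of $\phi^*$ and that $\lambda^{n-1}\ne 1$. Then, for every $k\ge 0$, there is an isomorphism of complex vector spaces (group cohomology) $$H^k(\Gamma_\phi;R_{n-1})\cong H^k(\Gamma_\phi;R_{n-3}).$$ -/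

import Mathlib

namespace FiberedThreeManifold

open scoped MatrixGroups commutatorElement

/-! ### The fundamental group of the punctured surface -/

/-- Generators of `π₁(S_{g,p})`: the standard generators `a i`, `b i` of the closed surface of
genus `g`, and the loops `c j` around the `p` punctures, all `c j` oriented coherently. -/
inductive SurfaceGenerator (g p : ℕ) : Type
  | a (i : Fin g) : SurfaceGenerator g p
  | b (i : Fin g) : SurfaceGenerator g p
  | c (j : Fin p) : SurfaceGenerator g p

/-- The word `[a 0, b 0] ⋯ [a (g-1), b (g-1)] (c 0 ⋯ c (p-1))⁻¹`. -/
def surfaceRelator (g p : ℕ) : FreeGroup (SurfaceGenerator g p) :=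
  (List.ofFn fun i : Fin g =>
      ⁅FreeGroup.of (SurfaceGenerator.a (p := p) i), FreeGroup.of (SurfaceGenerator.b i)⁆).prod *
    ((List.ofFn fun j : Fin p => FreeGroup.of (SurfaceGenerator.c (g := g) j)).prod)⁻¹

/-- `π₁(S_{g,p})` in its standard presentation
`⟨a i, b i, c j | ∏ [a i, b i] = ∏ c j⟩`. -/
abbrev SurfaceGroup (g p : ℕ) : Type :=
  PresentedGroup ({surfaceRelator g p} : Set (FreeGroup (SurfaceGenerator g p)))

/-- The class of the loop around the `j`-th puncture. -/
def punctureLoop (g p : ℕ) (j : Fin p) : SurfaceGroup g p :=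
  PresentedGroup.of (SurfaceGenerator.c j)

/-- The automorphisms of `π₁(S_{g,p})` induced by orientation-preserving homeomorphisms of
`S_{g,p}`: those which permute the conjugacy classes of the (oriented) loops around the
punctures. -/
def IsSurfaceMonodromy {g p : ℕ} (φ : MulAut (SurfaceGroup g p)) : Prop :=
  ∃ σ : Equiv.Perm (Fin p), ∀ j : Fin p,
    IsConj (punctureLoop g p (σ j)) (φ (punctureLoop g p j))

/-- `H¹(S_{g,p}; ℂ) = Hom(π₁(S_{g,p}), ℂ)`. -/
abbrev SurfaceH1 (g p : ℕ) : Type := Additive (SurfaceGroup g p) →+ ℂ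

/-- The map `φ^*` on `H¹(S_{g,p}; ℂ)`, `(φ^* u)(γ) = u(φ(γ))`. -/
def pullback {g p : ℕ} (φ : MulAut (SurfaceGroup g p)) : Module.End ℂ (SurfaceH1 g p) where
  toFun u := u.comp (MonoidHom.toAdditive φ.toMonoidHom)
  map_add' _ _ := rfl
  map_smul' _ _ := rfl

/-! ### The fundamental group of the mapping torus -/

/-- `Γ_φ = π₁(M_φ) = π₁(S_{g,p}) ⋊_φ ℤ`, with the generator `τ` of `ℤ` acting by
`τ γ τ⁻¹ = φ(γ)`. -/
abbrev MappingTorusGroup {g p : ℕ} (φ : MulAut (SurfaceGroup g p)) : Type :=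
  SurfaceGroup g p ⋊[zpowersHom (MulAut (SurfaceGroup g p)) φ] Multiplicative ℤ

/-- The inclusion `π₁(S_{g,p}) → Γ_φ` of the fibre group. -/
def fibre {g p : ℕ} (φ : MulAut (SurfaceGroup g p)) : SurfaceGroup g p →* MappingTorusGroup φ :=
  SemidirectProduct.inl

/-- The generator `τ` of the base circle. -/
def tau {g p : ℕ} (φ : MulAut (SurfaceGroup g p)) : MappingTorusGroup φ :=
  SemidirectProduct.inr (Multiplicative.ofAdd 1)

theorem tau_mul_fibre_mul_tau_inv {g p : ℕ} (φ : MulAut (SurfaceGroup g p))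
    (γ : SurfaceGroup g p) : tau φ * fibre φ γ * (tau φ)⁻¹ = fibre φ (φ γ) := by
  have h := SemidirectProduct.inl_aut (φ := zpowersHom (MulAut (SurfaceGroup g p)) φ)
    (Multiplicative.ofAdd 1) γ
  simpa [tau, fibre, zpowersHom_apply] using h.symm

/-! ### The reducible representation into `SL(2, ℂ)` -/

/-- `γ ↦ (1, u γ; 0, 1)`. -/
def unipotentHom {g p : ℕ} (u : SurfaceH1 g p) : SurfaceGroup g p →* SL(2, ℂ) where
  toFun γ := ⟨!![1, u (Additive.ofMul γ); 0, 1], by simp [Matrix.det_fin_two]⟩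
  map_one' := Subtype.ext <| by
    change !![1, u 0; 0, 1] = (1 : Matrix (Fin 2) (Fin 2) ℂ)
    rw [map_zero, Matrix.one_fin_two]
  map_mul' x y := Subtype.ext <| by
    change !![1, u (Additive.ofMul x + Additive.ofMul y); 0, 1] =
      !![1, u (Additive.ofMul x); 0, 1] * !![1, u (Additive.ofMul y); 0, 1]
    rw [map_add, Matrix.mul_fin_two]
    simp [add_comm]

/-- The matrix `diag(lam, lam⁻¹)`. -/
def diagonalElement (lam : ℂˣ) : SL(2, ℂ) :=
  ⟨!![(lam : ℂ), 0; 0, ((lam⁻¹ : ℂˣ) : ℂ)], by simp [Matrix.det_fin_two]⟩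

theorem unipotentHom_conj {g p : ℕ} (φ : MulAut (SurfaceGroup g p)) (lam : ℂˣ)
    (u : SurfaceH1 g p) (hu : pullback φ u = (lam : ℂ) ^ 2 • u) (γ : SurfaceGroup g p) :
    unipotentHom u (φ γ) = diagonalElement lam * unipotentHom u γ * (diagonalElement lam)⁻¹ := by
  have h : u (Additive.ofMul (φ γ)) = (lam : ℂ) ^ 2 * u (Additive.ofMul γ) :=
    DFunLike.congr_fun hu (Additive.ofMul γ)
  rw [eq_mul_inv_iff_mul_eq]
  apply Subtype.ext
  change !![1, u (Additive.ofMul (φ γ)); 0, 1] * !![(lam : ℂ), 0; 0, ((lam⁻¹ : ℂˣ) : ℂ)] =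
    !![(lam : ℂ), 0; 0, ((lam⁻¹ : ℂˣ) : ℂ)] * !![1, u (Additive.ofMul γ); 0, 1]
  have h2 : (lam : ℂ) ^ 2 * u (Additive.ofMul γ) * (lam : ℂ)⁻¹ =
      (lam : ℂ) * u (Additive.ofMul γ) := by
    field_simp
  rw [h, Matrix.mul_fin_two, Matrix.mul_fin_two]
  simp [h2]

theorem unipotentHom_zpow {g p : ℕ} (φ : MulAut (SurfaceGroup g p)) (lam : ℂˣ)
    (u : SurfaceH1 g p) (hu : pullback φ u = (lam : ℂ) ^ 2 • u) (k : Multiplicative ℤ) :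
    (unipotentHom u).comp (zpowersHom (MulAut (SurfaceGroup g p)) φ k).toMonoidHom =
      (MulAut.conj (zpowersHom SL(2, ℂ) (diagonalElement lam) k)).toMonoidHom.comp
        (unipotentHom u) := by
  have key : ∀ (m : ℤ) (γ : SurfaceGroup g p), unipotentHom u ((φ ^ m) γ) =
      diagonalElement lam ^ m * unipotentHom u γ * (diagonalElement lam ^ m)⁻¹ := by
    intro m
    induction m with
    | zero => simp
    | succ i ih =>
      intro γ
      rw [zpow_add_one, MulAut.mul_apply, ih, unipotentHom_conj φ lam u hu, zpow_add_one]
      group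
    | pred i ih =>
      intro γ
      have h := unipotentHom_conj φ lam u hu (φ⁻¹ γ)
      rw [MulAut.apply_inv_self] at h
      rw [zpow_sub_one, MulAut.mul_apply, ih, zpow_sub_one, h]
      group
  refine MonoidHom.ext fun γ => ?_
  exact key k.toAdd γ

/-- The representation `ρ_λ : Γ_φ → SL(2, ℂ)` attached to a class `u` with `φ^* u = λ² u`:
`ρ_λ(γ) = (1, u γ; 0, 1)` for `γ` in the fibre group, and `ρ_λ(τ) = diag(λ, λ⁻¹)`. -/
def rhoLambda {g p : ℕ} (φ : MulAut (SurfaceGroup g p)) (lam : ℂˣ)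
    (u : SurfaceH1 g p) (hu : pullback φ u = (lam : ℂ) ^ 2 • u) :
    MappingTorusGroup φ →* SL(2, ℂ) :=
  SemidirectProduct.lift (unipotentHom u) (zpowersHom SL(2, ℂ) (diagonalElement lam))
    (unipotentHom_zpow φ lam u hu)

theorem rhoLambda_fibre {g p : ℕ} (φ : MulAut (SurfaceGroup g p)) (lam : ℂˣ)
    (u : SurfaceH1 g p) (hu : pullback φ u = (lam : ℂ) ^ 2 • u) (γ : SurfaceGroup g p) :
    (rhoLambda φ lam u hu (fibre φ γ) : Matrix (Fin 2) (Fin 2) ℂ) =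
      !![1, u (Additive.ofMul γ); 0, 1] := by
  rw [rhoLambda, fibre, SemidirectProduct.lift_inl]
  rfl

theorem rhoLambda_tau {g p : ℕ} (φ : MulAut (SurfaceGroup g p)) (lam : ℂˣ)
    (u : SurfaceH1 g p) (hu : pullback φ u = (lam : ℂ) ^ 2 • u) :
    (rhoLambda φ lam u hu (tau φ) : Matrix (Fin 2) (Fin 2) ℂ) =
      !![(lam : ℂ), 0; 0, ((lam⁻¹ : ℂˣ) : ℂ)] := by
  rw [rhoLambda, tau, SemidirectProduct.lift_inr, zpowersHom_apply, toAdd_ofAdd, zpow_one]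
  rfl

/-! ### Binary forms -/

/-- The substitution `X ↦ d X - b Y`, `Y ↦ -c X + a Y` on `ℂ[X, Y]` given by the matrix
`(a, b; c, d)`, where `X = X 0` and `Y = X 1`. -/
noncomputable def formSubst (A : SL(2, ℂ)) :
    MvPolynomial (Fin 2) ℂ →ₐ[ℂ] MvPolynomial (Fin 2) ℂ :=
  MvPolynomial.aeval
    ![MvPolynomial.C (A 1 1) * MvPolynomial.X 0 - MvPolynomial.C (A 0 1) * MvPolynomial.X 1,
      -MvPolynomial.C (A 1 0) * MvPolynomial.X 0 + MvPolynomial.C (A 0 0) * MvPolynomial.X 1]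

theorem formSubst_one : formSubst 1 = AlgHom.id ℂ _ := by
  ext i : 1
  fin_cases i <;> simp [formSubst]

theorem formSubst_mul (A B : SL(2, ℂ)) :
    formSubst (A * B) = (formSubst A).comp (formSubst B) := by
  ext i : 1
  fin_cases i <;>
    simp [formSubst, Matrix.mul_apply, Fin.sum_univ_two, MvPolynomial.algHom_C] <;> ring

theorem formSubst_mem (m : ℕ) (A : SL(2, ℂ)) (f : MvPolynomial (Fin 2) ℂ)
    (hf : f ∈ MvPolynomial.homogeneousSubmodule (Fin 2) ℂ m) :
    formSubst A f ∈ MvPolynomial.homogeneousSubmodule (Fin 2) ℂ m := by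
  have hX : ∀ (z : ℂ) (i : Fin 2),
      (MvPolynomial.C z * MvPolynomial.X i : MvPolynomial (Fin 2) ℂ).IsHomogeneous 1 :=
    fun z i => MvPolynomial.IsHomogeneous.C_mul (MvPolynomial.isHomogeneous_X ℂ i) z
  have h := MvPolynomial.IsHomogeneous.aeval (R := ℂ) (τ := Fin 2) (n := 1) hf
    ![MvPolynomial.C (A 1 1) * MvPolynomial.X 0 - MvPolynomial.C (A 0 1) * MvPolynomial.X 1,
      -MvPolynomial.C (A 1 0) * MvPolynomial.X 0 + MvPolynomial.C (A 0 0) * MvPolynomial.X 1]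
    (by
      intro i
      fin_cases i
      · exact (hX (A 1 1) 0).sub (hX (A 0 1) 1)
      · simpa [neg_mul] using (hX (A 1 0) 0).neg.add (hX (A 0 0) 1))
  rw [one_mul] at h
  exact h

/-- The representation of `SL(2, ℂ)` on the space `R_m` of binary forms of degree `m`. -/
noncomputable def binaryForms (m : ℕ) :
    Representation ℂ SL(2, ℂ) (MvPolynomial.homogeneousSubmodule (Fin 2) ℂ m) where
  toFun A := (formSubst A).toLinearMap.restrict (formSubst_mem m A)
  map_one' := by
    ext f : 2
    simp [formSubst_one]
  map_mul' A B := by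
    refine LinearMap.ext fun f => Subtype.ext ?_
    change formSubst (A * B) f = formSubst A (formSubst B f)
    rw [formSubst_mul, AlgHom.comp_apply]

/-- The `Γ_φ`-module `R_m`, with `Γ_φ` acting through `ρ_λ`. -/
noncomputable def formsModule {g p : ℕ} (φ : MulAut (SurfaceGroup g p)) (lam : ℂˣ)
    (u : SurfaceH1 g p) (hu : pullback φ u = (lam : ℂ) ^ 2 • u) (m : ℕ) :
    Rep ℂ (MappingTorusGroup φ) :=
  Rep.of ((binaryForms m).comp (rhoLambda φ lam u hu))

end FiberedThreeManifold

/-! Write `χ` for the character of `Γ_φ` that is trivial on the fibre group and sends `τ` to `λ`.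
The image of `ρ_λ` is upper triangular, so `Y` spans a stable line with character `χ`, and `X` is
scaled by `χ⁻¹` modulo `Y`. With `n = m + 3` this gives two short exact sequences through the same
twisted module: `0 → ℂ(χ^(m+2)) → R_(m+2) → R_(m+1) ⊗ χ⁻¹ → 0`, whose maps are the inclusion of
`Y^(m+2)` and `∂/∂X`, and `0 → R_m → R_(m+1) ⊗ χ⁻¹ → ℂ(χ^(-(m+2))) → 0`, whose maps are
multiplication by `Y` and the coefficient of `X^(m+1)`. If both one-dimensional modules are acyclic,
the long exact sequences identify the cohomology of `R_(m+2)` and of `R_m` with that of the middle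
module.

A character trivial on the fibre with value `μ` on `τ` is acyclic when `μ ≠ 1` and `μ` is not an
eigenvalue of `φ^*` (`isZero_groupCohomology_characterModule`). Degrees 0 and 1 are direct. Since `p
≥ 1` the fibre group is free, so degree 2 reduces to surjectivity of `φ^* - μ` on `H¹`, and degrees
at least 3 vanish for every module.

The hypotheses give this for `μ = λ^(n-1)`. For the inverse, the spectrum of `φ^*` must be closed
under inversion (`hasEigenvalue_inv`). On classes vanishing at the punctures this follows from the
invariant intersection form. An eigenvector not vanishing there has a root of unity as eigenvalue,
and complex conjugation supplies the inverse. -/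

namespace FiberedThreeManifold

open CategoryTheory Limits

universe u

/-! ### Crossed homomorphisms -/

section CrossedHom

variable {k G A B : Type*} [CommRing k] [Group G] [AddCommGroup A] [Module k A]
  [AddCommGroup B] [Module k B]

/-- Crossed homomorphisms (one-cocycles) `G → A`. -/
def IsCrossedHom (ρ : Representation k G A) (f : G → A) : Prop :=
  ∀ g h : G, f (g * h) = ρ g (f h) + f g

namespace IsCrossedHom

variable {ρ : Representation k G A} {σ : Representation k G B} {f f' : G → A}

theorem map_one (hf : IsCrossedHom ρ f) : f 1 = 0 := by
  simpa using hf 1 1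

theorem map_inv (hf : IsCrossedHom ρ f) (g : G) : f g⁻¹ = -ρ g⁻¹ (f g) := by
  have h := hf g⁻¹ g
  rw [inv_mul_cancel, hf.map_one] at h
  exact (neg_eq_of_add_eq_zero_right h.symm).symm

theorem add (hf : IsCrossedHom ρ f) (hf' : IsCrossedHom ρ f') : IsCrossedHom ρ (f + f') := by
  intro g h
  simp only [Pi.add_apply, hf g h, hf' g h, _root_.map_add]
  abel

theorem sub (hf : IsCrossedHom ρ f) (hf' : IsCrossedHom ρ f') : IsCrossedHom ρ (f - f') := by
  intro g h
  simp only [Pi.sub_apply, hf g h, hf' g h, _root_.map_sub]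
  abel

theorem coboundary (ρ : Representation k G A) (a : A) : IsCrossedHom ρ fun g => ρ g a - a := by
  intro g h
  simp

theorem comp_linearMap (hf : IsCrossedHom ρ f) (p : A →ₗ[k] B)
    (hp : ∀ g a, p (ρ g a) = σ g (p a)) : IsCrossedHom σ fun g => p (f g) := by
  intro g h
  simp [hf g h, hp]

theorem of_comp_linearMap {p : A →ₗ[k] B} (hinj : Function.Injective p)
    (hp : ∀ g a, p (ρ g a) = σ g (p a)) (hf : IsCrossedHom σ fun g => p (f g)) :
    IsCrossedHom ρ f := by
  intro g h
  apply hinj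
  have := hf g h
  simpa [hp] using this

theorem comp_monoidHom {H : Type*} [Group H] (hf : IsCrossedHom ρ f) (i : H →* G) :
    IsCrossedHom (ρ.comp i) fun h => f (i h) := by
  intro g h
  simp [hf (i g)]

/-- The subgroup on which two crossed homomorphisms agree. -/
def eqLocus (hf : IsCrossedHom ρ f) (hf' : IsCrossedHom ρ f') : Subgroup G where
  carrier := {g | f g = f' g}
  mul_mem' {a b} (ha : f a = f' a) (hb : f b = f' b) := by
    change f (a * b) = f' (a * b)
    rw [hf, hf', ha, hb]
  one_mem' := by
    change f 1 = f' 1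
    rw [hf.map_one, hf'.map_one]
  inv_mem' {a} (ha : f a = f' a) := by
    change f a⁻¹ = f' a⁻¹
    rw [hf.map_inv, hf'.map_inv, ha]

end IsCrossedHom

/-- The affine bijection `x ↦ ρ(g) x + v`. -/
def affinePerm (ρ : Representation k G A) (g : G) (v : A) : Equiv.Perm A where
  toFun x := ρ g x + v
  invFun x := ρ g⁻¹ (x - v)
  left_inv x := by simp
  right_inv x := by simp

theorem affinePerm_apply (ρ : Representation k G A) (g : G) (v x : A) :
    affinePerm ρ g v x = ρ g x + v := rfl

/-- A crossed homomorphism is the same thing as an action by affine bijections. -/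
def IsCrossedHom.toPerm {ρ : Representation k G A} {f : G → A} (hf : IsCrossedHom ρ f) :
    G →* Equiv.Perm A where
  toFun g := affinePerm ρ g (f g)
  map_one' := by
    ext x
    simp [affinePerm_apply, hf.map_one]
  map_mul' g h := by
    ext x
    simp [affinePerm_apply, hf g h, add_assoc]

/-- The elements acting by an affine bijection with prescribed linear part. -/
def affineSubgroup (ρ : Representation k G A) (H : G →* Equiv.Perm A) : Subgroup G where
  carrier := {g | ∀ x, H g x = ρ g x + H g 0}
  mul_mem' {a b} (ha : ∀ x, H a x = ρ a x + H a 0) (hb : ∀ x, H b x = ρ b x + H b 0) := by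
    intro x
    simp only [map_mul, Equiv.Perm.mul_apply, Module.End.mul_apply]
    rw [ha, hb, ha (H b 0), map_add]
    abel
  one_mem' := by simp
  inv_mem' {a} (ha : ∀ x, H a x = ρ a x + H a 0) := by
    intro x
    simp only [map_inv]
    rw [Equiv.Perm.inv_eq_iff_eq, ha]
    have h0 := ha ((H a)⁻¹ 0)
    rw [← Equiv.Perm.mul_apply, mul_inv_cancel, Equiv.Perm.one_apply] at h0
    rw [map_add, add_assoc, ← h0]
    simp

theorem isCrossedHom_of_affineSubgroup_eq_top {ρ : Representation k G A}
    {H : G →* Equiv.Perm A} (h : affineSubgroup ρ H = ⊤) : IsCrossedHom ρ fun g => H g 0 := by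
  intro g g'
  have hg : g ∈ affineSubgroup ρ H := h ▸ Subgroup.mem_top g
  change H (g * g') 0 = _
  rw [map_mul, Equiv.Perm.mul_apply, hg]

theorem freeGroup_subgroup_eq_top {X : Type*} (S : Subgroup (FreeGroup X))
    (h : ∀ x, FreeGroup.of x ∈ S) : S = ⊤ := by
  rw [eq_top_iff, ← FreeGroup.closure_range_of, Subgroup.closure_le]
  rintro _ ⟨x, rfl⟩
  exact h x

end CrossedHom

/-- A group is a retract of a free group. -/
def IsRetractOfFree (N : Type u) [Group N] : Prop :=
  ∃ (X : Type u) (s : N →* FreeGroup X) (r : FreeGroup X →* N), ∀ γ, r (s γ) = γ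

/-- Crossed homomorphisms on a free group take arbitrary values on the generators, so lifting those
values lifts the whole cocycle; the lift is then restricted along the section `s`. This is the form
in which `H²(N; -) = 0` gets used. -/
theorem IsRetractOfFree.lift_crossedHom {N : Type u} {k A B : Type*} [Group N] [CommRing k]
    [AddCommGroup A] [Module k A] [AddCommGroup B] [Module k B] (hN : IsRetractOfFree N)
    {ρ : Representation k N A} {σ : Representation k N B} (p : A →ₗ[k] B)
    (hp : ∀ g a, p (ρ g a) = σ g (p a)) (hsurj : Function.Surjective p) {c : N → B}
    (hc : IsCrossedHom σ c) : ∃ f : N → A, IsCrossedHom ρ f ∧ ∀ γ, p (f γ) = c γ := by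
  obtain ⟨X, s, r, hrs⟩ := hN
  choose v hv using fun x : X => hsurj (c (r (FreeGroup.of x)))
  let H : FreeGroup X →* Equiv.Perm A :=
    FreeGroup.lift fun x => affinePerm (ρ.comp r) (FreeGroup.of x) (v x)
  have hH : ∀ x, H (FreeGroup.of x) = affinePerm (ρ.comp r) (FreeGroup.of x) (v x) :=
    fun x => FreeGroup.lift_apply_of
  have hcross : IsCrossedHom (ρ.comp r) fun w => H w 0 := by
    apply isCrossedHom_of_affineSubgroup_eq_top
    apply freeGroup_subgroup_eq_top
    intro x y
    rw [hH]
    simp [affinePerm_apply]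
  have hcross' : IsCrossedHom (σ.comp r) fun w => p (H w 0) :=
    hcross.comp_linearMap p fun g a => hp (r g) a
  have heq : hcross'.eqLocus (hc.comp_monoidHom r) = ⊤ := by
    apply freeGroup_subgroup_eq_top
    intro x
    change p (H (FreeGroup.of x) 0) = c (r (FreeGroup.of x))
    rw [hH, ← hv]
    simp [affinePerm_apply]
  refine ⟨fun γ => H (s γ) 0, fun g h => ?_, fun γ => ?_⟩
  · have := hcross (s g) (s h)
    simpa [hrs] using this
  · have : s γ ∈ hcross'.eqLocus (hc.comp_monoidHom r) := heq ▸ Subgroup.mem_top _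
    change p (H (s γ) 0) = c (r (s γ)) at this
    rw [this, hrs]

/-! ### Extensions by an infinite cyclic group -/

/-- The semidirect product `N ⋊_φ ℤ`. -/
abbrev CyclicExtension {N : Type u} [Group N] (φ : MulAut N) : Type u :=
  N ⋊[zpowersHom (MulAut N) φ] Multiplicative ℤ

namespace CyclicExtension

variable {N : Type u} [Group N] (φ : MulAut N)

/-- The inclusion of `N`. -/
def incl : N →* CyclicExtension φ := SemidirectProduct.inl

/-- The stable letter. -/
def stable : CyclicExtension φ := SemidirectProduct.inr (Multiplicative.ofAdd 1)

theorem stable_mul_incl (γ : N) : stable φ * incl φ γ = incl φ (φ γ) * stable φ := by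
  have h := SemidirectProduct.inl_aut (φ := zpowersHom (MulAut N) φ) (Multiplicative.ofAdd 1) γ
  rw [← mul_inv_eq_iff_eq_mul]
  simpa [stable, incl, zpowersHom_apply] using h.symm

theorem eq_incl_mul_zpow (x : CyclicExtension φ) :
    x = incl φ x.left * stable φ ^ (x.right.toAdd) := by
  rw [stable, ← map_zpow, ← ofAdd_zsmul, incl]
  simp [SemidirectProduct.inl_left_mul_inr_right]

theorem subgroup_eq_top (S : Subgroup (CyclicExtension φ)) (h1 : ∀ γ, incl φ γ ∈ S)
    (h2 : stable φ ∈ S) : S = ⊤ := by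
  rw [eq_top_iff]
  intro x _
  rw [eq_incl_mul_zpow φ x]
  exact S.mul_mem (h1 _) (S.zpow_mem h2 _)

variable {φ}

theorem comp_zpow {G : Type*} [Group G] (f : N →* G) (t : G)
    (h : ∀ γ, f (φ γ) = t * f γ * t⁻¹) (m : Multiplicative ℤ) :
    f.comp (zpowersHom (MulAut N) φ m).toMonoidHom =
      (MulAut.conj (zpowersHom G t m)).toMonoidHom.comp f := by
  have key : ∀ (m : ℤ) (γ : N), f ((φ ^ m) γ) = t ^ m * f γ * (t ^ m)⁻¹ := by
    intro m
    induction m with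
    | zero => simp
    | succ i ih =>
      intro γ
      rw [zpow_add_one, MulAut.mul_apply, ih, h, zpow_add_one]
      group
    | pred i ih =>
      intro γ
      have h := h (φ⁻¹ γ)
      rw [MulAut.apply_inv_self] at h
      rw [zpow_sub_one, MulAut.mul_apply, ih, zpow_sub_one, h]
      group
  exact MonoidHom.ext fun γ => key m.toAdd γ

/-- The homomorphism given by its restriction to `N` and the image of the stable letter. -/
def lift {G : Type*} [Group G] (f : N →* G) (t : G) (h : ∀ γ, f (φ γ) = t * f γ * t⁻¹) :
    CyclicExtension φ →* G :=
  SemidirectProduct.lift f (zpowersHom G t) (comp_zpow f t h)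

theorem lift_incl {G : Type*} [Group G] (f : N →* G) (t : G)
    (h : ∀ γ, f (φ γ) = t * f γ * t⁻¹) (γ : N) : lift f t h (incl φ γ) = f γ := by
  rw [lift, incl, SemidirectProduct.lift_inl]

theorem lift_stable {G : Type*} [Group G] (f : N →* G) (t : G)
    (h : ∀ γ, f (φ γ) = t * f γ * t⁻¹) : lift f t h (stable φ) = t := by
  rw [lift, stable, SemidirectProduct.lift_inr, zpowersHom_apply, toAdd_ofAdd, zpow_one]

section Crossed

variable {k A B : Type*} [CommRing k] [AddCommGroup A] [Module k A] [AddCommGroup B] [Module k B]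
  {ρ : Representation k (CyclicExtension φ) A} {σ : Representation k (CyclicExtension φ) B}

/-- The hypothesis `h` is the relation `τ γ = φ(γ) τ` written out for affine bijections with
translation parts `F` and `j`. -/
theorem exists_crossedHom {F : N → A} (hF : IsCrossedHom (ρ.comp (incl φ)) F) (j : A)
    (h : ∀ γ, F (φ γ) + ρ (incl φ (φ γ)) j = ρ (stable φ) (F γ) + j) :
    ∃ f : CyclicExtension φ → A, IsCrossedHom ρ f ∧ (∀ γ, f (incl φ γ) = F γ) ∧
      f (stable φ) = j := by
  have hcompat : ∀ γ, hF.toPerm (φ γ) =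
      affinePerm ρ (stable φ) j * hF.toPerm γ * (affinePerm ρ (stable φ) j)⁻¹ := by
    intro γ
    rw [eq_mul_inv_iff_mul_eq]
    ext x
    change ρ (incl φ (φ γ)) (ρ (stable φ) x + j) + F (φ γ) =
      ρ (stable φ) (ρ (incl φ γ) x + F γ) + j
    rw [map_add, map_add, ← Module.End.mul_apply, ← Module.End.mul_apply, ← map_mul, ← map_mul,
      stable_mul_incl, add_assoc, add_assoc, ← h γ, add_comm (F _)]
  let H := lift hF.toPerm (affinePerm ρ (stable φ) j) hcompat
  have h1 : ∀ γ, H (incl φ γ) 0 = F γ := by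
    intro γ
    simp only [H, lift_incl]
    change ρ (incl φ γ) 0 + F γ = _
    simp
  have h2 : H (stable φ) 0 = j := by
    simp only [H, lift_stable, affinePerm_apply]
    simp
  refine ⟨fun g => H g 0, ?_, h1, h2⟩
  apply isCrossedHom_of_affineSubgroup_eq_top
  apply subgroup_eq_top
  · intro γ x
    rw [h1]
    simp only [H, lift_incl]
    rfl
  · intro x
    rw [h2]
    simp only [H, lift_stable]
    rfl

theorem crossedHom_ext {f f' : CyclicExtension φ → A} (hf : IsCrossedHom ρ f)
    (hf' : IsCrossedHom ρ f') (h1 : ∀ γ, f (incl φ γ) = f' (incl φ γ))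
    (h2 : f (stable φ) = f' (stable φ)) (g : CyclicExtension φ) : f g = f' g := by
  have h : hf.eqLocus hf' = ⊤ := subgroup_eq_top φ _ h1 h2
  have hg : g ∈ hf.eqLocus hf' := h ▸ Subgroup.mem_top g
  exact hg

/-- The obstruction to extending crossed homomorphisms from `N` to `N ⋊ ℤ` vanishes. -/
def ExtensionCondition (ρ : Representation k (CyclicExtension φ) A) : Prop :=
  ∀ D : N → A, IsCrossedHom (ρ.comp (incl φ)) D →
    ∃ (w : N → A) (a : A), IsCrossedHom (ρ.comp (incl φ)) w ∧
      ∀ γ, D (φ γ) = ρ (stable φ) (w γ) - w (φ γ) + a - ρ (incl φ (φ γ)) a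

/-- Lifts over `N` and at `τ` exist separately; their failure to respect `τ γ = φ(γ) τ` is a crossed
homomorphism `N → A`. `ExtensionCondition` says exactly that this defect can be cancelled by
correcting the two lifts by elements coming from `A`. -/
theorem lift_crossedHom (hN : IsRetractOfFree N) {C : Type*} [AddCommGroup C] [Module k C]
    {τ : Representation k (CyclicExtension φ) C} (i : A →ₗ[k] B) (p : B →ₗ[k] C)
    (hi : ∀ g a, i (ρ g a) = σ g (i a)) (hp : ∀ g b, p (σ g b) = τ g (p b))
    (hinj : Function.Injective i) (hexact : ∀ b, p b = 0 → ∃ a, i a = b)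
    (hpi : ∀ a, p (i a) = 0)
    (hsurj : Function.Surjective p) (hA : ExtensionCondition ρ)
    {c : CyclicExtension φ → C} (hc : IsCrossedHom τ c) :
    ∃ f : CyclicExtension φ → B, IsCrossedHom σ f ∧ ∀ g, p (f g) = c g := by
  obtain ⟨F₀, hF₀, hF₀c⟩ := hN.lift_crossedHom (ρ := σ.comp (incl φ)) (σ := τ.comp (incl φ)) p
    (fun g b => hp _ b) hsurj (hc.comp_monoidHom (incl φ))
  obtain ⟨j, hj⟩ := hsurj (c (stable φ))
  -- At `δ = φ γ` this is the defect in the compatibility condition of `exists_crossedHom`. Indexing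
  -- by `δ` makes it a crossed homomorphism for the unmodified action of `N`.
  let E : N → B := fun δ => F₀ δ + σ (incl φ δ) j - j - σ (stable φ) (F₀ (φ⁻¹ δ))
  have hE : IsCrossedHom (σ.comp (incl φ)) E := by
    have h1 : IsCrossedHom (σ.comp (incl φ)) fun δ => σ (stable φ) (F₀ (φ⁻¹ δ)) := by
      intro g h
      have := stable_mul_incl φ (φ⁻¹ g)
      rw [MulAut.apply_inv_self] at this
      simp only [map_mul, hF₀ _ _, map_add, MonoidHom.comp_apply]
      rw [← Module.End.mul_apply, ← Module.End.mul_apply, ← map_mul, ← map_mul, this]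
    have h2 := (hF₀.add (IsCrossedHom.coboundary (σ.comp (incl φ)) j)).sub h1
    convert h2 using 1
    ext δ
    simp [E, add_sub_assoc]
  have hpE : ∀ δ, p (E δ) = 0 := by
    intro δ
    have := stable_mul_incl φ (φ⁻¹ δ)
    rw [MulAut.apply_inv_self] at this
    have h3 := congrArg c this
    rw [hc, hc] at h3
    simp only [E, map_sub, map_add, hp, hj, hF₀c]
    rw [sub_sub, sub_eq_zero, add_comm (c (stable φ)), h3, add_comm]
  choose D hD using fun δ => hexact (E δ) (hpE δ)
  have hDc : IsCrossedHom (ρ.comp (incl φ)) D := by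
    refine IsCrossedHom.of_comp_linearMap (σ := σ.comp (incl φ)) hinj (fun g a => hi _ a) ?_
    simpa only [hD] using hE
  obtain ⟨w, a, hw, hwa⟩ := hA D hDc
  have hF : IsCrossedHom (σ.comp (incl φ)) (F₀ + fun γ => i (w γ)) :=
    hF₀.add (hw.comp_linearMap i fun g a => hi _ a)
  obtain ⟨f, hf, hf1, hf2⟩ := exists_crossedHom hF (j + i a) (by
    intro γ
    have h4 := congrArg i (hwa γ)
    simp only [hD, E, MulAut.inv_apply_self, map_sub, map_add, hi] at h4
    simp only [Pi.add_apply, map_add]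
    rw [← sub_eq_zero] at h4 ⊢
    rw [← h4]
    abel)
  refine ⟨f, hf, ?_⟩
  apply crossedHom_ext (hf.comp_linearMap (σ := τ) p hp) hc
  · intro γ
    simp [hf1, hF₀c, hpi]
  · simp [hf2, hj, hpi]

end Crossed

end CyclicExtension

end FiberedThreeManifold

namespace FiberedThreeManifold

open CategoryTheory Limits

universe u

/-! ### Dimension shifting -/

section General

variable {k G : Type u} [CommRing k] [Group G]

/-- The representation coinduced from the trivial subgroup. -/
noncomputable abbrev coinduced (A : Rep.{u} k G) : Rep.{u} k G :=
  Rep.coind (⊥ : Subgroup G).subtype (Rep.res (⊥ : Subgroup G).subtype A)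

/-- The canonical embedding `a ↦ (g ↦ g a)`. -/
noncomputable def toCoinduced (A : Rep.{u} k G) : A ⟶ coinduced A :=
  Rep.resCoindToHom (⊥ : Subgroup G).subtype A _ (𝟙 _)

theorem toCoinduced_injective (A : Rep.{u} k G) : Function.Injective (toCoinduced A).hom := by
  intro a b h
  have := congrFun (congrArg Subtype.val h) 1
  simpa [toCoinduced] using this

instance (A : Rep.{u} k G) : Mono (toCoinduced A) :=
  (Rep.mono_iff_injective _).2 (toCoinduced_injective A)

/-- Shapiro's lemma reduces this to the cohomology of the trivial group. -/
theorem isZero_groupCohomology_coinduced (A : Rep.{u} k G) (n : ℕ) :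
    IsZero (groupCohomology (coinduced A) (n + 1)) :=
  (isZero_groupCohomology_succ_of_subsingleton _ n).of_iso (groupCohomology.coindIso _ _)

/-- The sequence `0 → A → coinduced A → Q → 0`. -/
noncomputable abbrev coinducedSequence (A : Rep.{u} k G) : ShortComplex (Rep.{u} k G) :=
  ShortComplex.mk (toCoinduced A) (cokernel.π (toCoinduced A)) (cokernel.condition _)

theorem coinducedSequence_shortExact (A : Rep.{u} k G) : (coinducedSequence A).ShortExact where
  exact := ShortComplex.exact_cokernel _

theorem ShortExact.rep_injective {X : ShortComplex (Rep.{u} k G)} (hX : X.ShortExact) :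
    Function.Injective X.f.hom :=
  (Rep.mono_iff_injective _).1 hX.mono_f

theorem ShortExact.rep_surjective {X : ShortComplex (Rep.{u} k G)} (hX : X.ShortExact) :
    Function.Surjective X.g.hom :=
  (Rep.epi_iff_surjective _).1 hX.epi_g

theorem ShortExact.rep_exists {X : ShortComplex (Rep.{u} k G)} (hX : X.ShortExact) (b : X.X₂)
    (hb : X.g.hom b = 0) : ∃ a, X.f.hom a = b :=
  (ShortComplex.moduleCat_exact_iff _).1
    (hX.exact.map (forget₂ (Rep.{u} k G) (ModuleCat.{u} k))) b hb

theorem ShortExact.rep_comp {X : ShortComplex (Rep.{u} k G)} (a : X.X₁) :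
    X.g.hom (X.f.hom a) = 0 := by
  have := congrArg (fun f : X.X₁ ⟶ X.X₃ => f.hom a) X.zero
  exact this

theorem shortExact_of_rep {X : ShortComplex (Rep.{u} k G)}
    (hinj : Function.Injective X.f.hom) (hsurj : Function.Surjective X.g.hom)
    (hexact : ∀ b : X.X₂, X.g.hom b = 0 → ∃ a, X.f.hom a = b) : X.ShortExact where
  exact := by
    apply (ShortComplex.exact_map_iff_of_faithful X (forget₂ (Rep.{u} k G) (ModuleCat.{u} k))).1
    exact (ShortComplex.moduleCat_exact_iff _).2 hexact
  mono_f := (Rep.mono_iff_injective _).2 hinj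
  epi_g := (Rep.epi_iff_surjective _).2 hsurj

/-- `H²` of the kernel vanishes if crossed homomorphisms lift along a surjection from a module
with trivial `H²`. -/
theorem isZero_H2_of_lift {X : ShortComplex (Rep.{u} k G)} (hX : X.ShortExact)
    (h2 : IsZero (groupCohomology X.X₂ 2))
    (hlift : ∀ c : G → X.X₃, IsCrossedHom X.X₃.ρ c →
      ∃ f : G → X.X₂, IsCrossedHom X.X₂.ρ f ∧ ∀ g, X.g.hom (f g) = c g) :
    IsZero (groupCohomology X.X₁ 2) := by
  have hepi : Epi (groupCohomology.map (MonoidHom.id G) X.g 1) := by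
    rw [ModuleCat.epi_iff_surjective]
    intro y
    induction y using groupCohomology.H1_induction_on with | @h c =>
    obtain ⟨f, hf, hfc⟩ := hlift c ((groupCohomology.mem_cocycles₁_iff _).1 c.2)
    refine ⟨groupCohomology.H1π _ ⟨f, (groupCohomology.mem_cocycles₁_iff _).2 hf⟩, ?_⟩
    have := groupCohomology.H1π_comp_map_apply (MonoidHom.id G) X.g
      ⟨f, (groupCohomology.mem_cocycles₁_iff _).2 hf⟩
    refine this.trans ?_
    congr 1
    ext g
    exact hfc g
  have hδ : Epi (groupCohomology.δ hX 1 2 rfl) := groupCohomology.epi_δ_of_isZero hX 1 h2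
  have hz : groupCohomology.map (MonoidHom.id G) X.g 1 ≫ groupCohomology.δ hX 1 2 rfl = 0 :=
    (groupCohomology.mapShortComplex₃ hX (i := 1) (j := 2) rfl).zero
  have h0 : groupCohomology.δ hX 1 2 rfl = 0 := by
    rw [← cancel_epi (groupCohomology.map (MonoidHom.id G) X.g 1), hz, comp_zero]
  rw [IsZero.iff_id_eq_zero, ← cancel_epi (groupCohomology.δ hX 1 2 rfl), h0]
  simp

theorem isZero_of_isZero_pred {X : ShortComplex (Rep.{u} k G)} (hX : X.ShortExact) (n : ℕ)
    (h2 : IsZero (groupCohomology X.X₂ (n + 1))) (h3 : IsZero (groupCohomology X.X₃ n)) :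
    IsZero (groupCohomology X.X₁ (n + 1)) := by
  have := groupCohomology.epi_δ_of_isZero hX n h2
  exact IsZero.of_epi (groupCohomology.δ hX n (n + 1) rfl) h3

theorem isZero_H0 (A : Rep.{u} k G) (h : ∀ a : A, (∀ g, A.ρ g a = a) → a = 0) :
    IsZero (groupCohomology A 0) := by
  refine IsZero.of_iso ?_ (groupCohomology.H0Iso A)
  rw [ModuleCat.isZero_iff_subsingleton]
  exact ⟨fun a b => Subtype.ext <| (h a.1 a.2).trans (h b.1 b.2).symm⟩

theorem isZero_H1 (A : Rep.{u} k G)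
    (h : ∀ f : G → A, IsCrossedHom A.ρ f → ∃ a, ∀ g, f g = A.ρ g a - a) :
    IsZero (groupCohomology A 1) := by
  rw [ModuleCat.isZero_iff_subsingleton]
  refine ⟨fun x y => ?_⟩
  have key : ∀ x : groupCohomology A 1, x = 0 := by
    intro x
    induction x using groupCohomology.H1_induction_on with | @h c =>
    obtain ⟨a, ha⟩ := h c ((groupCohomology.mem_cocycles₁_iff _).1 c.2)
    exact (groupCohomology.H1π_eq_zero_iff _).2 ⟨a, funext fun g => (ha g).symm⟩
  rw [key x, key y]

/-- The long exact sequence when the cohomology of the kernel vanishes. -/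
theorem nonempty_linearEquiv_of_isZero_left {X : ShortComplex (Rep.{u} k G)} (hX : X.ShortExact)
    (h : ∀ n, IsZero (groupCohomology X.X₁ n)) (n : ℕ) :
    Nonempty (groupCohomology X.X₂ n ≃ₗ[k] groupCohomology X.X₃ n) := by
  have h1 : Mono (groupCohomology.map (MonoidHom.id G) X.g n) :=
    (groupCohomology.mapShortComplex₂_exact hX n).mono_g ((h n).eq_of_src _ _)
  have h2 : Epi (groupCohomology.map (MonoidHom.id G) X.g n) :=
    (groupCohomology.mapShortComplex₃_exact hX (i := n) rfl).epi_f ((h (n + 1)).eq_of_tgt _ _)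
  have : IsIso (groupCohomology.map (MonoidHom.id G) X.g n) := isIso_of_mono_of_epi _
  exact ⟨(asIso (groupCohomology.map (MonoidHom.id G) X.g n)).toLinearEquiv⟩

/-- The long exact sequence when the cohomology of the quotient vanishes. -/
theorem nonempty_linearEquiv_of_isZero_right {X : ShortComplex (Rep.{u} k G)} (hX : X.ShortExact)
    (h : ∀ n, IsZero (groupCohomology X.X₃ n)) (n : ℕ) :
    Nonempty (groupCohomology X.X₁ n ≃ₗ[k] groupCohomology X.X₂ n) := by
  have h2 : Epi (groupCohomology.map (MonoidHom.id G) X.f n) :=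
    (groupCohomology.mapShortComplex₂_exact hX n).epi_f ((h n).eq_of_tgt _ _)
  have h1 : Mono (groupCohomology.map (MonoidHom.id G) X.f n) := by
    cases n with
    | zero =>
      rw [ModuleCat.mono_iff_injective]
      have : Mono (groupCohomology.map (MonoidHom.id G) X.f 0) := by
        have := hX.mono_f
        infer_instance
      exact (ModuleCat.mono_iff_injective _).1 this
    | succ n =>
      exact (groupCohomology.mapShortComplex₁_exact hX (i := n) rfl).mono_g
        ((h n).eq_of_src _ _)
  have : IsIso (groupCohomology.map (MonoidHom.id G) X.f n) := isIso_of_mono_of_epi _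
  exact ⟨(asIso (groupCohomology.map (MonoidHom.id G) X.f n)).toLinearEquiv⟩

end General

/-! ### Cohomology of `N ⋊ ℤ` in degrees two and above -/

namespace CyclicExtension

variable {k N : Type u} [CommRing k] [Group N] {φ : MulAut N}

/-- Dimension shifting along the coinduced sequence: `H²` of `A` is the cokernel on `H¹` of the
surjection onto the quotient, and crossed homomorphisms lift along it. -/
theorem isZero_H2 (hN : IsRetractOfFree N) (A : Rep.{u} k (CyclicExtension φ))
    (hA : ExtensionCondition A.ρ) : IsZero (groupCohomology A 2) := by
  have hX := coinducedSequence_shortExact A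
  refine isZero_H2_of_lift hX (isZero_groupCohomology_coinduced A 1) fun c hc => ?_
  exact lift_crossedHom hN (toCoinduced A).hom.toLinearMap
    (coinducedSequence A).g.hom.toLinearMap
    (fun g a => Rep.hom_comm_apply _ g a) (fun g a => Rep.hom_comm_apply _ g a)
    (ShortExact.rep_injective hX) (ShortExact.rep_exists hX)
    (ShortExact.rep_comp (X := coinducedSequence A))
    (ShortExact.rep_surjective hX) hA hc

/-- `N` acts freely on the extension by right translation, so a function-valued cocycle is
determined by its values on a transversal and has a primitive. -/
theorem exists_function_eq_sub {A : Type*} [AddCommGroup A] (F : N → CyclicExtension φ → A)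
    (hF : ∀ g h x, F (g * h) x = F h (x * incl φ g) + F g x) :
    ∃ b : CyclicExtension φ → A, ∀ γ x, F γ x = b (x * incl φ γ) - b x := by
  -- The factorization `x = τ^k q(x)`, with the power of `τ` on the left, so that right
  -- multiplication by `N` changes `q` alone.
  let q : CyclicExtension φ → N := fun x => (zpowersHom (MulAut N) φ x.right)⁻¹ x.left
  let r : CyclicExtension φ → CyclicExtension φ := fun x => SemidirectProduct.inr x.right
  have hq : ∀ x, r x * incl φ (q x) = x := by
    intro x
    ext <;> simp [q, r, incl]
  have hqmul : ∀ x γ, q (x * incl φ γ) = q x * γ := by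
    intro x γ
    simp [q, incl]
  have hr : ∀ x γ, r (x * incl φ γ) = r x := by
    intro x γ
    simp [r, incl]
  clear_value q r
  refine ⟨fun x => F (q x) (r x), fun γ x => ?_⟩
  change _ = F (q (x * incl φ γ)) (r (x * incl φ γ)) - F (q x) (r x)
  rw [hqmul, hr, hF, hq, add_sub_cancel_right]

/-- Crossed homomorphisms from `N` to a coinduced module are principal. -/
theorem exists_eq_coboundary_coinduced (A : Rep.{u} k (CyclicExtension φ))
    {c : N → coinduced A} (hc : IsCrossedHom ((coinduced A).ρ.comp (incl φ)) c) :
    ∃ b : coinduced A, ∀ γ, c γ = (coinduced A).ρ (incl φ γ) b - b := by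
  obtain ⟨b, hb⟩ := exists_function_eq_sub (φ := φ) (fun γ x => (c γ).1 x) fun g h x =>
    congrArg (fun f : coinduced A => f.1 x) (hc g h)
  refine ⟨⟨b, ?_⟩, fun γ => Subtype.ext (funext fun x => hb γ x)⟩
  rintro ⟨g, hg⟩ h
  obtain rfl : g = 1 := Subgroup.mem_bot.1 hg
  have : (⟨1, hg⟩ : (⊥ : Subgroup (CyclicExtension φ))) = 1 := rfl
  rw [this, map_one, map_one, one_mul]
  rfl

/-- Crossed homomorphisms from `N` to the quotient lift to the coinduced module, where they are
principal. Hence `D` itself is principal and `w = 0` suffices. -/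
theorem extensionCondition_cokernel (hN : IsRetractOfFree N) (A : Rep.{u} k (CyclicExtension φ)) :
    ExtensionCondition (cokernel (toCoinduced A)).ρ := by
  intro D hD
  obtain ⟨c, hc, hcD⟩ := hN.lift_crossedHom (ρ := (coinduced A).ρ.comp (incl φ))
    (σ := (cokernel (toCoinduced A)).ρ.comp (incl φ))
    (cokernel.π (toCoinduced A)).hom.toLinearMap
    (fun g a => Rep.hom_comm_apply (cokernel.π (toCoinduced A)) _ a)
    (ShortExact.rep_surjective (coinducedSequence_shortExact A)) hD
  obtain ⟨b, hb⟩ := exists_eq_coboundary_coinduced A hc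
  refine ⟨0, -(cokernel.π (toCoinduced A)).hom b, fun g h => by simp, fun γ => ?_⟩
  rw [← hcD, hb]
  have := Rep.hom_comm_apply (cokernel.π (toCoinduced A)) (incl φ (φ γ)) b
  change (cokernel.π (toCoinduced A)).hom (_ - _) = _
  rw [map_sub, this]
  simp
  abel

/-- One shift turns `H³(A)` into `H²` of the quotient by `A` of its coinduced module, for which the
extension condition is automatic; further shifts give the higher degrees. -/
theorem isZero_of_three_le (hN : IsRetractOfFree N) (n : ℕ) :
    ∀ A : Rep.{u} k (CyclicExtension φ), IsZero (groupCohomology A (n + 3)) := by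
  induction n with
  | zero =>
    intro A
    exact isZero_of_isZero_pred (coinducedSequence_shortExact A) 2
      (isZero_groupCohomology_coinduced A 2) (isZero_H2 hN _ (extensionCondition_cokernel hN A))
  | succ n ih =>
    intro A
    exact isZero_of_isZero_pred (coinducedSequence_shortExact A) (n + 3)
      (isZero_groupCohomology_coinduced A _) (ih _)

end CyclicExtension

end FiberedThreeManifold

namespace FiberedThreeManifold

open scoped MatrixGroups commutatorElement

/-! ### The surface group -/

section Surface

variable {g p : ℕ}

theorem lift_surfaceRelator {G : Type*} [Group G] (f : SurfaceGenerator g p → G) :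
    FreeGroup.lift f (surfaceRelator g p) =
      (List.ofFn fun i => ⁅f (.a i), f (.b i)⁆).prod * ((List.ofFn fun j => f (.c j)).prod)⁻¹ := by
  simp only [surfaceRelator, map_mul, map_inv, map_list_prod, List.map_ofFn]
  congr 3 <;> simp [Function.comp_def, map_commutatorElement]

/-- The homomorphism from the surface group given by the images of the generators. -/
def surfaceLift {G : Type*} [Group G] (f : SurfaceGenerator g p → G)
    (hf : (List.ofFn fun i => ⁅f (.a i), f (.b i)⁆).prod = (List.ofFn fun j => f (.c j)).prod) :
    SurfaceGroup g p →* G :=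
  PresentedGroup.toGroup (f := f) (by
    rintro _ rfl
    rw [lift_surfaceRelator, hf, mul_inv_cancel])

theorem surfaceLift_of {G : Type*} [Group G] (f : SurfaceGenerator g p → G)
    (hf : (List.ofFn fun i => ⁅f (.a i), f (.b i)⁆).prod = (List.ofFn fun j => f (.c j)).prod)
    (x : SurfaceGenerator g p) : surfaceLift f hf (PresentedGroup.of x) = f x :=
  PresentedGroup.toGroup.of _

theorem surface_relation :
    (List.ofFn fun i => ⁅(PresentedGroup.of (.a i) : SurfaceGroup g p),
      PresentedGroup.of (.b i)⁆).prod = (List.ofFn fun j => punctureLoop g p j).prod := by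
  have h1 : (PresentedGroup.mk {surfaceRelator g p}) (surfaceRelator g p) = 1 :=
    PresentedGroup.one_of_mem rfl
  have h2 : (FreeGroup.lift fun x => (PresentedGroup.of x : SurfaceGroup g p)) =
      PresentedGroup.mk {surfaceRelator g p} := by
    ext x
    simp [PresentedGroup.of]
  rw [← h2, lift_surfaceRelator] at h1
  exact mul_inv_eq_one.1 h1

/-- With a puncture present, the relation can be solved for the last loop `c`. Sending that
generator to its expression in the others gives a section into the free group on all generators. -/
theorem isRetractOfFree_surfaceGroup (hp : 1 ≤ p) : IsRetractOfFree (SurfaceGroup g p) := by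
  obtain ⟨q, rfl⟩ : ∃ q, p = q + 1 := ⟨p - 1, by omega⟩
  let f : SurfaceGenerator g (q + 1) → FreeGroup (SurfaceGenerator g (q + 1)) := fun
    | .a i => FreeGroup.of (.a i)
    | .b i => FreeGroup.of (.b i)
    | .c j => Fin.lastCases (motive := fun _ => FreeGroup (SurfaceGenerator g (q + 1)))
        ((List.ofFn fun j : Fin q => FreeGroup.of (SurfaceGenerator.c j.castSucc)).prod⁻¹ *
          (List.ofFn fun i : Fin g =>
            ⁅FreeGroup.of (SurfaceGenerator.a (p := q + 1) i), FreeGroup.of (SurfaceGenerator.b i)⁆).prod)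
        (fun j => FreeGroup.of (.c j.castSucc)) j
  have hf : (List.ofFn fun i => ⁅f (.a i), f (.b i)⁆).prod =
      (List.ofFn fun j => f (.c j)).prod := by
    rw [List.ofFn_succ' (n := q)]
    simp [f]
  refine ⟨_, surfaceLift f hf, PresentedGroup.mk _, fun γ => ?_⟩
  have : (PresentedGroup.mk _).comp (surfaceLift f hf) = MonoidHom.id _ := by
    refine PresentedGroup.ext fun x => ?_
    rw [MonoidHom.comp_apply, surfaceLift_of]
    rcases x with i | i | j
    · rfl
    · rfl
    · refine Fin.lastCases ?_ (fun j => ?_) j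
      · have h := surface_relation (g := g) (p := q + 1)
        rw [List.ofFn_succ' (n := q), List.concat_eq_append, List.prod_append,
          List.prod_singleton, ← inv_mul_eq_iff_eq_mul] at h
        simp only [f, Fin.lastCases_last, map_mul, map_inv, map_list_prod, List.map_ofFn,
          Function.comp_def, map_commutatorElement]
        exact h
      · simp only [f, Fin.lastCases_castSucc]
        rfl
  exact DFunLike.congr_fun this γ

instance : Finite (SurfaceGenerator g p) :=
  Finite.of_injective
    (fun x : SurfaceGenerator g p => match x with
      | .a i => (Sum.inl i : Fin g ⊕ (Fin g ⊕ Fin p))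
      | .b i => Sum.inr (Sum.inl i)
      | .c j => Sum.inr (Sum.inr j))
    (by rintro (_ | _ | _) (_ | _ | _) h <;> simp_all)

/-- The values of a class on the generators. -/
def evalGenerators (g p : ℕ) : SurfaceH1 g p →ₗ[ℂ] (SurfaceGenerator g p → ℂ) where
  toFun u x := u (Additive.ofMul (PresentedGroup.of x))
  map_add' _ _ := rfl
  map_smul' _ _ := rfl

theorem surfaceH1_ext {u v : SurfaceH1 g p}
    (h : ∀ x, u (Additive.ofMul (PresentedGroup.of x)) = v (Additive.ofMul (PresentedGroup.of x))) :
    u = v := by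
  apply MonoidHom.toAdditiveLeft.symm.injective
  exact PresentedGroup.ext h

theorem evalGenerators_injective : Function.Injective (evalGenerators g p) :=
  fun _ _ h => surfaceH1_ext fun x => congrFun h x

instance : FiniteDimensional ℂ (SurfaceH1 g p) :=
  FiniteDimensional.of_injective (evalGenerators g p) evalGenerators_injective

/-- The classes vanishing on the puncture loops. -/
def closedH1 (g p : ℕ) : Submodule ℂ (SurfaceH1 g p) where
  carrier := {u | ∀ j, u (Additive.ofMul (punctureLoop g p j)) = 0}
  add_mem' hu hv j := by simp [hu j, hv j]
  zero_mem' j := rfl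
  smul_mem' c u hu j := by simp [hu j]

theorem exists_closedH1 (α β : Fin g → ℂ) : ∃ v ∈ closedH1 g p,
    (∀ i, v (Additive.ofMul (PresentedGroup.of (.a i))) = α i) ∧
      ∀ i, v (Additive.ofMul (PresentedGroup.of (.b i))) = β i := by
  let f : SurfaceGenerator g p → Multiplicative ℂ := fun
    | .a i => Multiplicative.ofAdd (α i)
    | .b i => Multiplicative.ofAdd (β i)
    | .c _ => 1
  have hf : (List.ofFn fun i => ⁅f (.a i), f (.b i)⁆).prod =
      (List.ofFn fun j => f (.c j)).prod := by
    have hcomm : ∀ x y : Multiplicative ℂ, ⁅x, y⁆ = 1 := fun x y => by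
      rw [commutatorElement_eq_one_iff_mul_comm]
      exact mul_comm x y
    simp [f, hcomm]
  exact ⟨MonoidHom.toAdditiveLeft (surfaceLift f hf),
    fun j => surfaceLift_of f hf (.c j), fun i => surfaceLift_of f hf (.a i),
    fun i => surfaceLift_of f hf (.b i)⟩

/-! ### The intersection form and its invariance under the monodromy -/

/-- The intersection form. -/
def intersectionForm (u v : SurfaceH1 g p) : ℂ :=
  ∑ i : Fin g, (u (Additive.ofMul (PresentedGroup.of (.a i))) *
      v (Additive.ofMul (PresentedGroup.of (.b i))) -
    u (Additive.ofMul (PresentedGroup.of (.b i))) * v (Additive.ofMul (PresentedGroup.of (.a i))))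

theorem intersectionForm_smul_left (c : ℂ) (u v : SurfaceH1 g p) :
    intersectionForm (c • u) v = c * intersectionForm u v := by
  simp only [intersectionForm, Finset.mul_sum]
  refine Finset.sum_congr rfl fun i _ => ?_
  simp
  ring

theorem intersectionForm_sub_smul_right (c : ℂ) (u v w : SurfaceH1 g p) :
    intersectionForm u (v - c • w) = intersectionForm u v - c * intersectionForm u w := by
  simp only [intersectionForm, Finset.mul_sum, ← Finset.sum_sub_distrib]
  refine Finset.sum_congr rfl fun i _ => ?_
  simp
  ring

/-- The values on the `a i` and `b i` can be prescribed freely within `closedH1`, so pairing with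
dual classes reads off each value of `u`. -/
theorem intersectionForm_nondegenerate {u : SurfaceH1 g p} (hu : u ∈ closedH1 g p)
    (h : ∀ v ∈ closedH1 g p, intersectionForm u v = 0) : u = 0 := by
  apply surfaceH1_ext
  rintro (i | i | j)
  · obtain ⟨v, hv, hva, hvb⟩ := exists_closedH1 (g := g) (p := p) 0 (Pi.single i 1)
    have := h v hv
    simpa [intersectionForm, hva, hvb, Pi.single_apply] using this
  · obtain ⟨v, hv, hva, hvb⟩ := exists_closedH1 (g := g) (p := p) (Pi.single i 1) 0
    have := h v hv
    simpa [intersectionForm, hva, hvb, Pi.single_apply] using this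
  · exact hu j

/-- `w` is a one-cochain whose coboundary is, up to sign, the cup product of `u` and `v`. -/
def IsCupPrimitive (u v : SurfaceH1 g p) (w : SurfaceGroup g p → ℂ) : Prop :=
  ∀ x y, w (x * y) = w x + w y + u (Additive.ofMul x) * v (Additive.ofMul y)

/-- Let `γ` act on `ℂ²` by `(1, u γ; 0, 1)`. Lifting `v` to a crossed homomorphism into this
extension of `ℂ` by `ℂ` produces `w` as its first coordinate. -/
theorem exists_isCupPrimitive (hp : 1 ≤ p) (u v : SurfaceH1 g p) :
    ∃ w, IsCupPrimitive u v w := by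
  let ρ : Representation ℂ (SurfaceGroup g p) (ℂ × ℂ) :=
    { toFun := fun γ => LinearMap.prod
        (LinearMap.fst ℂ ℂ ℂ + u (Additive.ofMul γ) • LinearMap.snd ℂ ℂ ℂ) (LinearMap.snd ℂ ℂ ℂ)
      map_one' := by ext <;> simp
      map_mul' := by
        intro x y
        ext <;> simp [add_comm] }
  obtain ⟨f, hf, hfv⟩ := (isRetractOfFree_surfaceGroup (g := g) hp).lift_crossedHom (ρ := ρ)
    (σ := Representation.trivial ℂ _ ℂ) (LinearMap.snd ℂ ℂ ℂ) (fun _ _ => rfl)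
    Prod.snd_surjective (c := fun γ => v (Additive.ofMul γ)) (fun x y => by simp [add_comm])
  refine ⟨fun γ => (f γ).1, fun x y => ?_⟩
  have h := congrArg Prod.fst (hf x y)
  have h2 : (f y).2 = v (Additive.ofMul y) := hfv y
  change (f (x * y)).1 = ((f y).1 + u (Additive.ofMul x) * (f y).2) + (f x).1 at h
  change (f (x * y)).1 = (f x).1 + (f y).1 + _
  rw [h, h2]
  ring

namespace IsCupPrimitive

variable {u v : SurfaceH1 g p} {w : SurfaceGroup g p → ℂ} (h : IsCupPrimitive u v w)
include h

theorem map_one : w 1 = 0 := by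
  have := h 1 1
  simpa using this

theorem map_list_prod (l : List (SurfaceGroup g p)) (hl : ∀ x ∈ l, u (Additive.ofMul x) = 0) :
    w l.prod = (l.map w).sum := by
  induction l with
  | nil => simpa using h.map_one
  | cons x l ih =>
    rw [List.prod_cons, h, ih fun y hy => hl y (List.mem_cons_of_mem _ hy),
      hl x List.mem_cons_self]
    simp

theorem map_commutator (x y : SurfaceGroup g p) :
    w ⁅x, y⁆ = u (Additive.ofMul x) * v (Additive.ofMul y) -
      u (Additive.ofMul y) * v (Additive.ofMul x) := by
  have h0 : u (Additive.ofMul ⁅x, y⁆) = 0 := by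
    simp [commutatorElement_def]
  have h1 : ⁅x, y⁆ * (y * x) = x * y := by
    simp [commutatorElement_def, mul_assoc]
  have h2 := congrArg w h1
  rw [h, h, h x y, h0] at h2
  linear_combination h2

theorem map_eq_of_isConj {c d : SurfaceGroup g p} (hu : u (Additive.ofMul c) = 0)
    (hv : v (Additive.ofMul c) = 0) (hcd : IsConj c d) : w d = w c := by
  obtain ⟨x, hx⟩ := isConj_iff.1 hcd
  have h0 : u (Additive.ofMul d) = 0 := by
    simp [← hx, hu]
  have h1 : d * x = x * c := by
    simp [← hx]
  have h2 := congrArg w h1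
  rw [h, h, h0, hv] at h2
  linear_combination h2

/-- A discrete Stokes formula: `w` is evaluated on both sides of the surface relation, and each
commutator contributes one term of the form. -/
theorem intersectionForm_eq (hu : u ∈ closedH1 g p) :
    intersectionForm u v = ∑ j, w (punctureLoop g p j) := by
  have h1 := congrArg w (surface_relation (g := g) (p := p))
  rw [h.map_list_prod, h.map_list_prod] at h1
  · simp only [List.map_ofFn, List.sum_ofFn, Function.comp_apply, h.map_commutator] at h1
    exact h1
  · intro x hx
    obtain ⟨j, rfl⟩ := (List.mem_ofFn' _ _).1 hx
    exact hu j
  · intro x hx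
    obtain ⟨i, rfl⟩ := (List.mem_ofFn' _ _).1 hx
    simp [commutatorElement_def]

theorem pullback (φ : MulAut (SurfaceGroup g p)) :
    IsCupPrimitive (pullback φ u) (FiberedThreeManifold.pullback φ v) fun x => w (φ x) := by
  intro x y
  simp only [map_mul, h (φ x) (φ y)]
  rfl

end IsCupPrimitive

theorem pullback_apply (φ : MulAut (SurfaceGroup g p)) (u : SurfaceH1 g p)
    (γ : SurfaceGroup g p) : pullback φ u (Additive.ofMul γ) = u (Additive.ofMul (φ γ)) := rfl

theorem map_eq_of_isConj (u : SurfaceH1 g p) {c d : SurfaceGroup g p} (h : IsConj c d) :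
    u (Additive.ofMul d) = u (Additive.ofMul c) := by
  obtain ⟨x, hx⟩ := isConj_iff.1 h
  simp [← hx]

theorem pullback_mem_closedH1 {φ : MulAut (SurfaceGroup g p)} (hφ : IsSurfaceMonodromy φ)
    {u : SurfaceH1 g p} (hu : u ∈ closedH1 g p) : pullback φ u ∈ closedH1 g p := by
  obtain ⟨σ, hσ⟩ := hφ
  intro j
  rw [pullback_apply, map_eq_of_isConj u (hσ j), hu]

/-- If `w` is a primitive for `u, v`, then `w ∘ φ` is one for the pullbacks. On puncture loops `w`
depends only on the conjugacy class, so the boundary sum is merely permuted by `σ`. -/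
theorem intersectionForm_pullback (hp : 1 ≤ p) {φ : MulAut (SurfaceGroup g p)}
    (hφ : IsSurfaceMonodromy φ) {u v : SurfaceH1 g p} (hu : u ∈ closedH1 g p)
    (hv : v ∈ closedH1 g p) :
    intersectionForm (pullback φ u) (pullback φ v) = intersectionForm u v := by
  obtain ⟨w, hw⟩ := exists_isCupPrimitive hp u v
  rw [hw.intersectionForm_eq hu, (hw.pullback φ).intersectionForm_eq (pullback_mem_closedH1 hφ hu)]
  obtain ⟨σ, hσ⟩ := hφ
  exact (Finset.sum_congr rfl fun j _ => hw.map_eq_of_isConj (hu _) (hv _) (hσ j)).trans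
    (Equiv.sum_comp σ fun j => w (punctureLoop g p j))

/-! ### Symmetry of the spectrum of the monodromy -/

/-- The complex conjugate class. -/
noncomputable def conjH1 (u : SurfaceH1 g p) : SurfaceH1 g p :=
  (starRingEnd ℂ).toAddMonoidHom.comp u

theorem sub_smul_injective {V : Type*} [AddCommGroup V] [Module ℂ V] {T : Module.End ℂ V} {μ : ℂ}
    (h : ¬ T.HasEigenvalue μ) : Function.Injective (T - μ • (1 : Module.End ℂ V)) := by
  rw [injective_iff_map_eq_zero]
  intro v hv
  by_contra hne
  refine h (Module.End.hasEigenvalue_of_hasEigenvector (x := v)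
    (Module.End.hasEigenvector_iff.2 ⟨Module.End.mem_eigenspace_iff.2 ?_, hne⟩))
  simpa [sub_eq_zero] using hv

/-- The puncture loops are permuted up to conjugacy, so a nonzero value on one of them forces `μ ^
orderOf σ = 1`. -/
theorem norm_eq_one_of_notMem_closedH1 {φ : MulAut (SurfaceGroup g p)}
    (hφ : IsSurfaceMonodromy φ) {u : SurfaceH1 g p} {μ : ℂ} (hu : pullback φ u = μ • u)
    (hne : u ∉ closedH1 g p) : ‖μ‖ = 1 := by
  obtain ⟨σ, hσ⟩ := hφ
  obtain ⟨j, hj⟩ : ∃ j, u (Additive.ofMul (punctureLoop g p j)) ≠ 0 := by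
    by_contra! h
    exact hne h
  have h1 : ∀ j, u (Additive.ofMul (punctureLoop g p (σ j))) =
      μ * u (Additive.ofMul (punctureLoop g p j)) := by
    intro j
    rw [← map_eq_of_isConj u (hσ j), ← pullback_apply, hu]
    rfl
  have h2 : ∀ n : ℕ, u (Additive.ofMul (punctureLoop g p ((σ ^ n) j))) =
      μ ^ n * u (Additive.ofMul (punctureLoop g p j)) := by
    intro n
    induction n with
    | zero => simp
    | succ n ih => rw [pow_succ', Equiv.Perm.mul_apply, h1, ih, pow_succ', mul_assoc]
  have h3 := h2 (orderOf σ)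
  rw [pow_orderOf_eq_one, Equiv.Perm.one_apply] at h3
  have h4 : μ ^ orderOf σ = 1 := mul_right_cancel₀ hj (by rw [← h3, one_mul])
  exact Complex.norm_eq_one_of_pow_eq_one h4 (orderOf_pos σ).ne'

/-- The spectrum of the monodromy on `H¹` is closed under inversion. -/
theorem hasEigenvalue_inv (hp : 1 ≤ p) {φ : MulAut (SurfaceGroup g p)}
    (hφ : IsSurfaceMonodromy φ) {μ : ℂ} (hμ : μ ≠ 0) (h : (pullback φ).HasEigenvalue μ) :
    (pullback φ).HasEigenvalue μ⁻¹ := by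
  obtain ⟨u, hu⟩ := h.exists_hasEigenvector
  by_cases hW : u ∈ closedH1 g p
  -- If `μ⁻¹` were not an eigenvalue, every `v` in `closedH1` would be `φ^* x - μ⁻¹ x` with `x` in
  -- `closedH1`. Invariance gives `⟨u, φ^* x⟩ = μ⁻¹ ⟨u, x⟩`, so `u` would pair to zero with
  -- everything.
  · by_contra hcon
    have hinj := sub_smul_injective hcon
    have hmaps : ∀ v ∈ closedH1 g p,
        (pullback φ - μ⁻¹ • (1 : Module.End ℂ (SurfaceH1 g p))) v ∈ closedH1 g p :=
      fun v hv => Submodule.sub_mem _ (pullback_mem_closedH1 hφ hv) (Submodule.smul_mem _ _ hv)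
    have hsurj : Function.Surjective
        ((pullback φ - μ⁻¹ • (1 : Module.End ℂ (SurfaceH1 g p))).restrict hmaps) :=
      LinearMap.injective_iff_surjective.1 fun x y hxy =>
        Subtype.ext (hinj (congrArg Subtype.val hxy))
    refine hu.2 (intersectionForm_nondegenerate hW fun v hv => ?_)
    obtain ⟨⟨x, hx⟩, hxv⟩ := hsurj ⟨v, hv⟩
    have hv' : v = pullback φ x - μ⁻¹ • x := (congrArg Subtype.val hxv).symm
    have h1 := intersectionForm_pullback hp hφ hW hx
    rw [hu.apply_eq_smul, intersectionForm_smul_left] at h1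
    rw [hv', intersectionForm_sub_smul_right, ← h1]
    field_simp
    ring
  -- Here `μ⁻¹` is the conjugate of `μ`; as `φ^*` commutes with conjugation, the conjugate class is
  -- an eigenvector for it.
  · have h1 := norm_eq_one_of_notMem_closedH1 hφ hu.apply_eq_smul hW
    refine Module.End.hasEigenvalue_of_hasEigenvector (x := conjH1 u)
      (Module.End.hasEigenvector_iff.2 ⟨Module.End.mem_eigenspace_iff.2 ?_, fun h0 => hu.2 ?_⟩)
    · rw [Complex.inv_eq_conj h1]
      refine DFunLike.ext _ _ fun γ => ?_
      have h2 := DFunLike.congr_fun hu.apply_eq_smul γ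
      have h3 := congrArg (starRingEnd ℂ) h2
      rw [AddMonoidHom.smul_apply, smul_eq_mul, map_mul] at h3
      exact h3
    · refine DFunLike.ext _ _ fun γ => ?_
      have h2 := DFunLike.congr_fun h0 γ
      change (starRingEnd ℂ) (u γ) = 0 at h2
      simpa using h2

end Surface

end FiberedThreeManifold

namespace FiberedThreeManifold

open CategoryTheory Limits

/-! ### One-dimensional modules of the mapping torus group -/

/-- The twist of a representation by a character. -/
noncomputable def twist {G V : Type*} [Group G] [AddCommGroup V] [Module ℂ V] (χ : G →* ℂˣ)
    (ρ : Representation ℂ G V) : Representation ℂ G V where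
  toFun g := (χ g : ℂ) • ρ g
  map_one' := by simp
  map_mul' x y := by
    ext v
    simp [mul_smul]
    rw [smul_comm]

/-- The one-dimensional module given by a character. -/
noncomputable abbrev characterModule {G : Type} [Group G] (χ : G →* ℂˣ) : Rep ℂ G :=
  Rep.of (twist χ (Representation.trivial ℂ G ℂ))

theorem characterModule_apply {G : Type} [Group G] (χ : G →* ℂˣ) (g : G) (z : ℂ) :
    (characterModule χ).ρ g z = (χ g : ℂ) * z := rfl

theorem surjective_sub_smul {V : Type*} [AddCommGroup V] [Module ℂ V] [FiniteDimensional ℂ V]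
    {T : Module.End ℂ V} {μ : ℂ} (h : ¬ T.HasEigenvalue μ) :
    Function.Surjective (T - μ • (1 : Module.End ℂ V)) :=
  LinearMap.injective_iff_surjective.1 (sub_smul_injective h)

section

variable {g p : ℕ} {φ : MulAut (SurfaceGroup g p)} {χ : MappingTorusGroup φ →* ℂˣ} {μ : ℂ}

/-- Degree 0 needs only `μ ≠ 1`. A 1-cocycle restricts on the fibre to a solution of `φ^* v = μ v`,
hence to zero, and its value at `τ` is a coboundary because `μ - 1` is invertible. In degree 2 the
extension condition is surjectivity of `φ^* - μ`, which follows from injectivity in finite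
dimension. -/
theorem isZero_groupCohomology_characterModule (hp : 1 ≤ p)
    (hχ : ∀ γ, χ (CyclicExtension.incl φ γ) = 1)
    (hμ : (χ (CyclicExtension.stable φ) : ℂ) = μ) (h1 : μ ≠ 1)
    (hev : ¬ (pullback φ).HasEigenvalue μ) (n : ℕ) :
    IsZero (groupCohomology (characterModule χ) n) := by
  have hN : IsRetractOfFree (SurfaceGroup g p) := isRetractOfFree_surfaceGroup hp
  have hincl : ∀ γ (z : ℂ), (characterModule χ).ρ (CyclicExtension.incl φ γ) z = z := by
    intro γ z
    rw [characterModule_apply, hχ, Units.val_one, one_mul]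
  have hstable : ∀ z : ℂ, (characterModule χ).ρ (CyclicExtension.stable φ) z = μ * z := by
    intro z
    rw [characterModule_apply, hμ]
  have hsub : μ - 1 ≠ 0 := sub_ne_zero.2 h1
  match n with
  | 0 =>
    refine isZero_H0 _ fun a ha => ?_
    have h := ha (CyclicExtension.stable φ)
    rw [hstable] at h
    have h' : (μ - 1) * (a : ℂ) = 0 := by
      rw [sub_mul, h, one_mul, sub_self]
    exact (mul_eq_zero.1 h').resolve_left hsub
  | 1 =>
    refine isZero_H1 _ fun f hf => ?_
    let v : SurfaceH1 g p :=
      { toFun := fun γ => f (CyclicExtension.incl φ γ.toMul)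
        map_zero' := by
          rw [toMul_zero, map_one]
          exact hf.map_one
        map_add' := fun x y => by
          rw [toMul_add, map_mul, hf, hincl, add_comm] }
    have hv : pullback φ v = μ • v := by
      refine DFunLike.ext _ _ fun γ => ?_
      have h := congrArg f (CyclicExtension.stable_mul_incl φ γ.toMul)
      rw [hf, hf, hstable, hincl, add_comm] at h
      exact (add_left_cancel h).symm
    have hv0 : v = 0 := by
      by_contra hne
      exact hev (Module.End.hasEigenvalue_of_hasEigenvector
        (Module.End.hasEigenvector_iff.2 ⟨Module.End.mem_eigenspace_iff.2 hv, hne⟩))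
    let a : ℂ := (f (CyclicExtension.stable φ) : ℂ) / (μ - 1)
    refine ⟨a, CyclicExtension.crossedHom_ext hf (IsCrossedHom.coboundary _ a) ?_ ?_⟩
    · intro γ
      rw [hincl, sub_self]
      exact DFunLike.congr_fun hv0 (Additive.ofMul γ)
    · rw [hstable]
      change (f (CyclicExtension.stable φ) : ℂ) = μ * a - a
      simp only [a]
      field_simp
  | 2 =>
    refine CyclicExtension.isZero_H2 hN _ fun D hD => ?_
    let v : SurfaceH1 g p :=
      { toFun := fun γ => D γ.toMul
        map_zero' := hD.map_one
        map_add' := fun x y => by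
          rw [toMul_add, hD, MonoidHom.comp_apply, hincl, add_comm] }
    -- The fibre acts trivially, so the terms in `a` cancel and the condition reads `φ^* D = μ w -
    -- φ^* w`.
    obtain ⟨w, hw⟩ := surjective_sub_smul hev (-pullback φ v)
    refine ⟨fun γ => w (Additive.ofMul γ), 0, fun x y => ?_, fun γ => ?_⟩
    · rw [MonoidHom.comp_apply, hincl, add_comm]
      exact map_add w (Additive.ofMul x) (Additive.ofMul y)
    · have h : w (Additive.ofMul (φ γ)) - μ * w (Additive.ofMul γ) = -D (φ γ) :=
        DFunLike.congr_fun hw (Additive.ofMul γ)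
      rw [hstable, map_zero, add_zero, sub_zero, ← neg_inj, ← h, neg_sub]
  | n + 3 => exact CyclicExtension.isZero_of_three_le hN n _

end

end FiberedThreeManifold

namespace FiberedThreeManifold

open CategoryTheory Limits MvPolynomial
open scoped MatrixGroups

/-! ### Binary forms and upper triangular substitutions -/

section Forms

theorem fin_two_degree (e : Fin 2 →₀ ℕ) : e.degree = e 0 + e 1 := by
  rw [Finsupp.degree_eq_sum, Fin.sum_univ_two]

theorem formSubst_X_zero (A : SL(2, ℂ)) :
    formSubst A (X 0) = C (A 1 1) * X 0 - C (A 0 1) * X 1 := by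
  simp [formSubst]

theorem formSubst_X_one (A : SL(2, ℂ)) (hA : A 1 0 = 0) :
    formSubst A (X 1) = C (A 0 0) * X 1 := by
  simp [formSubst, hA]

/-- An upper triangular substitution sends `Y` to a multiple of `Y`, so in the chain rule only the
image of `X` contributes, with factor `A 1 1`. -/
theorem pderiv_formSubst (A : SL(2, ℂ)) (hA : A 1 0 = 0) (f : MvPolynomial (Fin 2) ℂ) :
    pderiv 0 (formSubst A f) = A 1 1 • formSubst A (pderiv 0 f) := by
  induction f using MvPolynomial.induction_on with
  | C a => simp [algHom_C]
  | add f h hf hh => simp [hf, hh]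
  | mul_X f i hf =>
    rw [map_mul, Derivation.leibniz, hf, Derivation.leibniz]
    fin_cases i
    · simp [formSubst_X_zero, smul_eq_C_mul]
      ring
    · simp [formSubst_X_one A hA, smul_eq_C_mul]
      ring

theorem eval_eq_pow_mul_coeff {m : ℕ} {f : MvPolynomial (Fin 2) ℂ} (hf : f.IsHomogeneous m)
    (t : ℂ) : eval ![t, 0] f = t ^ m * coeff (Finsupp.single 0 m) f := by
  rw [eval_eq']
  rw [Finset.sum_eq_single (Finsupp.single 0 m)]
  · simp [mul_comm]
  · intro e he hne
    by_cases h1 : e 1 = 0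
    · exfalso
      refine (mem_support_iff.1 he) (hf.coeff_eq_zero fun hd => hne ?_)
      rw [fin_two_degree] at hd
      ext i
      fin_cases i
      · simp; omega
      · simp [h1]
    · simp [h1]
  · intro h
    rw [notMem_support_iff.1 h, zero_mul]

theorem eval_eq_coeff {m : ℕ} {f : MvPolynomial (Fin 2) ℂ} (hf : f.IsHomogeneous m) :
    eval ![1, 0] f = coeff (Finsupp.single 0 m) f := by
  rw [eval_eq_pow_mul_coeff hf, one_pow, one_mul]

theorem eval_formSubst (A : SL(2, ℂ)) (hA : A 1 0 = 0) {m : ℕ} {f : MvPolynomial (Fin 2) ℂ}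
    (hf : f.IsHomogeneous m) :
    eval ![1, 0] (formSubst A f) = A 1 1 ^ m * eval ![1, 0] f := by
  have h1 : eval ![1, 0] (formSubst A f) = eval ![A 1 1, 0] f := by
    have : (aeval (![1, 0] : Fin 2 → ℂ)).comp (formSubst A) =
        aeval (![A 1 1, 0] : Fin 2 → ℂ) := by
      ext i
      fin_cases i <;> simp [formSubst, hA]
    have h := DFunLike.congr_fun this f
    simpa [coe_aeval_eq_eval] using h
  rw [h1, eval_eq_pow_mul_coeff hf, eval_eq_coeff hf]

theorem formSubst_smul_X_one_pow (A : SL(2, ℂ)) (hA : A 1 0 = 0) (z : ℂ) (m : ℕ) :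
    formSubst A (z • X 1 ^ m) = (A 0 0 ^ m * z) • X 1 ^ m := by
  rw [map_smul, map_pow, formSubst_X_one A hA, mul_pow, ← C_pow, ← smul_eq_C_mul, smul_smul,
    mul_comm]

theorem exists_eq_of_pderiv_eq_zero {m : ℕ} {f : MvPolynomial (Fin 2) ℂ}
    (hf : f.IsHomogeneous m) (h : pderiv 0 f = 0) : ∃ c : ℂ, c • X 1 ^ m = f := by
  refine ⟨coeff (Finsupp.single 1 m) f, ?_⟩
  ext e
  rw [coeff_smul, coeff_X_pow, smul_eq_mul]
  split_ifs with he
  · rw [he, mul_one]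
  · rw [mul_zero]
    by_cases h0 : e 0 = 0
    · refine (hf.coeff_eq_zero fun hd => he ?_).symm
      rw [fin_two_degree] at hd
      ext i
      fin_cases i
      · simp [h0]
      · simp; omega
    · have hle : Finsupp.single 0 1 ≤ e := by
        rw [Finsupp.single_le_iff]
        omega
      have h1 := congrArg (coeff (e - Finsupp.single 0 1)) h
      rw [coeff_pderiv, tsub_add_cancel_of_le hle, coeff_zero] at h1
      refine ((mul_eq_zero.1 h1).resolve_right ?_).symm
      exact Nat.cast_add_one_ne_zero _

theorem exists_pderiv_eq {m : ℕ} {f : MvPolynomial (Fin 2) ℂ} (hf : f.IsHomogeneous m) :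
    ∃ h : MvPolynomial (Fin 2) ℂ, h.IsHomogeneous (m + 1) ∧ pderiv 0 h = f := by
  refine ⟨∑ e ∈ f.support,
    monomial (e + Finsupp.single 0 1) (coeff e f * ((e 0 : ℂ) + 1)⁻¹), ?_, ?_⟩
  · refine IsHomogeneous.sum _ _ _ fun e he => isHomogeneous_monomial _ ?_
    by_contra hne
    refine (mem_support_iff.1 he) (hf.coeff_eq_zero fun hd => hne ?_)
    rw [map_add, hd, Finsupp.degree_single]
  · conv_rhs => rw [f.as_sum]
    rw [map_sum]
    refine Finset.sum_congr rfl fun e _ => ?_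
    rw [pderiv_monomial, add_tsub_cancel_right]
    congr 1
    have : ((e 0 : ℂ) + 1) ≠ 0 := Nat.cast_add_one_ne_zero _
    simp
    field_simp

/-- The value at `(1, 0)` is the coefficient of the pure power of `X`, the only monomial of this
degree not divisible by `Y`. -/
theorem exists_X_mul_eq {m : ℕ} {f : MvPolynomial (Fin 2) ℂ} (hf : f.IsHomogeneous (m + 1))
    (h : eval ![1, 0] f = 0) :
    ∃ h : MvPolynomial (Fin 2) ℂ, h.IsHomogeneous m ∧ X 1 * h = f := by
  refine ⟨f.divMonomial (Finsupp.single 1 1), fun {e} he => ?_, ?_⟩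
  · rw [coeff_divMonomial] at he
    by_contra hne
    refine he (hf.coeff_eq_zero fun hd => hne ?_)
    change Finsupp.weight (fun _ => 1) e = m
    rw [← Finsupp.degree_eq_weight_one]
    rw [map_add, Finsupp.degree_single] at hd
    omega
  · conv_rhs => rw [← divMonomial_add_modMonomial_single f 1]
    rw [left_eq_add]
    ext e
    rw [coeff_zero]
    by_cases h1 : e 1 = 0
    · rw [coeff_modMonomial_of_not_le _ (by rw [Finsupp.single_le_iff]; omega)]
      by_cases hd : e.degree = m + 1
      · have : e = Finsupp.single 0 (m + 1) := by
          rw [fin_two_degree] at hd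
          ext i
          fin_cases i
          · simp; omega
          · simp [h1]
        rw [this, ← eval_eq_coeff hf, h]
      · exact hf.coeff_eq_zero hd
    · exact coeff_modMonomial_of_le _ (by rw [Finsupp.single_le_iff]; omega)

end Forms

/-! ### The exact sequences -/

section Sequences

variable {g p : ℕ} {φ : MulAut (SurfaceGroup g p)} {lam : ℂˣ} {u : SurfaceH1 g p}
  (hu : pullback φ u = (lam : ℂ) ^ 2 • u)

/-- The character trivial on the fibre group and with value `lam` on `τ`. -/
def baseCharacter (φ : MulAut (SurfaceGroup g p)) (lam : ℂˣ) : MappingTorusGroup φ →* ℂˣ :=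
  (zpowersHom ℂˣ lam).comp SemidirectProduct.rightHom

theorem baseCharacter_incl (γ : SurfaceGroup g p) :
    baseCharacter φ lam (CyclicExtension.incl φ γ) = 1 := by
  simp [baseCharacter, CyclicExtension.incl]

theorem baseCharacter_stable : baseCharacter φ lam (CyclicExtension.stable φ) = lam := by
  simp [baseCharacter, CyclicExtension.stable, zpowersHom_apply]

/-- The upper triangular subgroup of `SL(2, ℂ)`. -/
def upperTriangular : Subgroup SL(2, ℂ) where
  carrier := {A | A 1 0 = 0}
  mul_mem' {A B} (hA : A 1 0 = 0) (hB : B 1 0 = 0) := by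
    change (A * B) 1 0 = 0
    simp [Matrix.SpecialLinearGroup.coe_mul, Matrix.mul_apply, Fin.sum_univ_two, hA, hB]
  one_mem' := by simp
  inv_mem' {A} (hA : A 1 0 = 0) := by
    change (A⁻¹) 1 0 = 0
    rw [Matrix.SpecialLinearGroup.SL2_inv_expl]
    simpa using hA

/-- The lower diagonal entry of an upper triangular matrix. -/
def lowerEntry : upperTriangular →* ℂ where
  toFun A := A.1 1 1
  map_one' := by simp
  map_mul' A B := by
    have hA : A.1 1 0 = 0 := A.2
    change (A.1 * B.1) 1 1 = _
    simp [Matrix.SpecialLinearGroup.coe_mul, Matrix.mul_apply, Fin.sum_univ_two, hA]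

theorem rhoLambda_mem_upperTriangular (x : MappingTorusGroup φ) :
    rhoLambda φ lam u hu x ∈ upperTriangular := by
  have h : upperTriangular.comap (rhoLambda φ lam u hu) = ⊤ := by
    apply CyclicExtension.subgroup_eq_top
    · intro γ
      change (rhoLambda φ lam u hu (fibre φ γ)).1 1 0 = 0
      rw [rhoLambda_fibre]
      rfl
    · change (rhoLambda φ lam u hu (tau φ)).1 1 0 = 0
      rw [rhoLambda_tau]
      rfl
  exact Subgroup.mem_comap.1 (h ▸ Subgroup.mem_top x)

theorem rhoLambda_one_zero (x : MappingTorusGroup φ) : rhoLambda φ lam u hu x 1 0 = 0 :=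
  rhoLambda_mem_upperTriangular hu x

theorem rhoLambda_one_one (x : MappingTorusGroup φ) :
    rhoLambda φ lam u hu x 1 1 = ((baseCharacter φ lam x)⁻¹ : ℂˣ) := by
  let f : MappingTorusGroup φ →* ℂ := lowerEntry.comp
    ((rhoLambda φ lam u hu).codRestrict upperTriangular (rhoLambda_mem_upperTriangular hu))
  have h : f.toHomUnits.eqLocus (baseCharacter φ lam)⁻¹ = ⊤ := by
    apply CyclicExtension.subgroup_eq_top
    · intro γ
      apply Units.ext
      change (rhoLambda φ lam u hu (fibre φ γ)).1 1 1 = ((baseCharacter φ lam _)⁻¹ : ℂˣ)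
      rw [rhoLambda_fibre, baseCharacter_incl]
      simp
    · apply Units.ext
      change (rhoLambda φ lam u hu (tau φ)).1 1 1 = ((baseCharacter φ lam _)⁻¹ : ℂˣ)
      rw [rhoLambda_tau, baseCharacter_stable]
      rfl
  have hx : x ∈ f.toHomUnits.eqLocus (baseCharacter φ lam)⁻¹ := h ▸ Subgroup.mem_top x
  exact congrArg Units.val hx

theorem rhoLambda_zero_zero (x : MappingTorusGroup φ) :
    rhoLambda φ lam u hu x 0 0 = (baseCharacter φ lam x : ℂ) := by
  have h := (rhoLambda φ lam u hu x).2
  rw [Matrix.det_fin_two] at h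
  have h1 : (rhoLambda φ lam u hu x).1 1 1 = _ := rhoLambda_one_one hu x
  have h0 : (rhoLambda φ lam u hu x).1 1 0 = 0 := rhoLambda_one_zero hu x
  rw [h1, h0, mul_zero, sub_zero, Units.val_inv_eq_inv_val] at h
  exact (mul_inv_eq_one₀ (Units.ne_zero _)).1 h

/-- The forms of degree `m`, twisted by the inverse of the base character. -/
noncomputable abbrev twistedForms (m : ℕ) : Rep ℂ (MappingTorusGroup φ) :=
  Rep.of (twist (baseCharacter φ lam)⁻¹ ((binaryForms m).comp (rhoLambda φ lam u hu)))

/-- Differentiation with respect to `X`. -/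
noncomputable def derivForms (m : ℕ) : formsModule φ lam u hu (m + 1) ⟶ twistedForms hu m :=
  Rep.ofHom (LinearMap.intertwiningMap_of_isIntertwiningMap _ _
    (LinearMap.restrict (pderiv 0 : Derivation ℂ (MvPolynomial (Fin 2) ℂ) _).toLinearMap
      (p := homogeneousSubmodule (Fin 2) ℂ (m + 1)) (q := homogeneousSubmodule (Fin 2) ℂ m)
      fun f hf => IsHomogeneous.pderiv hf) fun x f => Subtype.ext (by
        change pderiv 0 (formSubst (rhoLambda φ lam u hu x) f.1) =
          (((baseCharacter φ lam x)⁻¹ : ℂˣ) : ℂ) •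
            formSubst (rhoLambda φ lam u hu x) (pderiv 0 f.1)
        rw [pderiv_formSubst _ (rhoLambda_one_zero hu x), rhoLambda_one_one]))

/-- Multiplication by `Y`. -/
noncomputable def mulForms (m : ℕ) : formsModule φ lam u hu m ⟶ twistedForms hu (m + 1) :=
  Rep.ofHom (LinearMap.intertwiningMap_of_isIntertwiningMap _ _
    (LinearMap.restrict (LinearMap.mulLeft ℂ (X 1 : MvPolynomial (Fin 2) ℂ))
      (p := homogeneousSubmodule (Fin 2) ℂ m) (q := homogeneousSubmodule (Fin 2) ℂ (m + 1))
      fun f hf => by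
        rw [add_comm]
        exact (isHomogeneous_X ℂ 1).mul hf) fun x f => Subtype.ext (by
        change X 1 * formSubst (rhoLambda φ lam u hu x) f.1 =
          (((baseCharacter φ lam x)⁻¹ : ℂˣ) : ℂ) •
            formSubst (rhoLambda φ lam u hu x) (X 1 * f.1)
        rw [map_mul, formSubst_X_one _ (rhoLambda_one_zero hu x), rhoLambda_zero_zero,
          smul_eq_C_mul, ← mul_assoc, ← mul_assoc, ← C_mul, Units.inv_mul, C_1, one_mul]))

/-- The form `z Y ^ m`. -/
noncomputable def powMap (m : ℕ) : ℂ →ₗ[ℂ] homogeneousSubmodule (Fin 2) ℂ m where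
  toFun z := ⟨z • X 1 ^ m, Submodule.smul_mem _ _ (isHomogeneous_X_pow 1 m)⟩
  map_add' _ _ := Subtype.ext (add_smul _ _ _)
  map_smul' _ _ := Subtype.ext (mul_smul _ _ _)

/-- The inclusion of the line spanned by `Y ^ m`. -/
noncomputable def powForms (m : ℕ) :
    characterModule (baseCharacter φ lam ^ m) ⟶ formsModule φ lam u hu m :=
  Rep.ofHom (LinearMap.intertwiningMap_of_isIntertwiningMap _ _ (powMap m) fun x z =>
    Subtype.ext (by
      have h := formSubst_smul_X_one_pow _ (rhoLambda_one_zero hu x) z m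
      rw [rhoLambda_zero_zero, ← Units.val_pow_eq_pow_val] at h
      exact h.symm))

/-- The coefficient of `X ^ m`. -/
noncomputable def evalForms (m : ℕ) :
    twistedForms hu m ⟶ characterModule ((baseCharacter φ lam)⁻¹ ^ (m + 1)) :=
  Rep.ofHom (LinearMap.intertwiningMap_of_isIntertwiningMap _ _
    ((aeval (![1, 0] : Fin 2 → ℂ)).toLinearMap ∘ₗ (homogeneousSubmodule (Fin 2) ℂ m).subtype)
      fun x f => by
        change eval ![1, 0] ((((baseCharacter φ lam x)⁻¹ : ℂˣ) : ℂ) •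
            formSubst (rhoLambda φ lam u hu x) f.1) =
          (((baseCharacter φ lam x)⁻¹ ^ (m + 1) : ℂˣ) : ℂ) * eval ![1, 0] f.1
        rw [smul_eval, eval_formSubst _ (rhoLambda_one_zero hu x) f.2, rhoLambda_one_one,
          ← mul_assoc, ← pow_succ', Units.val_pow_eq_pow_val])

theorem derivForms_apply (m : ℕ) (f : homogeneousSubmodule (Fin 2) ℂ (m + 1)) :
    Subtype.val (p := (· ∈ homogeneousSubmodule (Fin 2) ℂ m)) ((derivForms hu m).hom f) =
      pderiv 0 f.1 := rfl

theorem mulForms_apply (m : ℕ) (f : homogeneousSubmodule (Fin 2) ℂ m) :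
    Subtype.val (p := (· ∈ homogeneousSubmodule (Fin 2) ℂ (m + 1))) ((mulForms hu m).hom f) =
      X 1 * f.1 := rfl

theorem powForms_apply (m : ℕ) (z : ℂ) :
    Subtype.val (p := (· ∈ homogeneousSubmodule (Fin 2) ℂ m))
      ((powForms (φ := φ) (lam := lam) hu m).hom z) = z • X 1 ^ m := rfl

theorem evalForms_apply (m : ℕ) (f : homogeneousSubmodule (Fin 2) ℂ m) :
    (evalForms hu m).hom f = eval ![1, 0] (f : MvPolynomial (Fin 2) ℂ) := rfl

theorem powForms_comp_derivForms (m : ℕ) : powForms hu (m + 1) ≫ derivForms hu m = 0 := by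
  refine Rep.hom_ext (DFunLike.ext _ _ fun z => Subtype.ext ?_)
  refine (derivForms_apply hu m ((powForms hu (m + 1)).hom z)).trans ?_
  rw [powForms_apply]
  change _ = (0 : MvPolynomial (Fin 2) ℂ)
  simp

theorem mulForms_comp_evalForms (m : ℕ) : mulForms hu m ≫ evalForms hu (m + 1) = 0 := by
  refine Rep.hom_ext (DFunLike.ext _ _ fun f => ?_)
  refine (evalForms_apply hu (m + 1) ((mulForms hu m).hom f)).trans ?_
  refine (congrArg (eval ![1, 0]) (mulForms_apply hu m f)).trans ?_
  change _ = (0 : ℂ)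
  simp

/-- Characteristic zero enters twice: forms killed by `∂/∂X` are multiples of a power of `Y`, and
every form has an antiderivative in `X`. -/
theorem derivForms_shortExact (m : ℕ) :
    (ShortComplex.mk (powForms hu (m + 1)) (derivForms hu m)
      (powForms_comp_derivForms hu m)).ShortExact := by
  refine shortExact_of_rep (fun z w h => ?_) (fun f => ?_) (fun f h => ?_)
  · have h1 := congrArg Subtype.val h
    exact smul_left_injective ℂ (pow_ne_zero _ (X_ne_zero 1)) h1
  · obtain ⟨h, hh, hhf⟩ := exists_pderiv_eq f.2
    exact ⟨(⟨h, hh⟩ : homogeneousSubmodule (Fin 2) ℂ (m + 1)), Subtype.ext hhf⟩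
  · obtain ⟨c, hc⟩ := exists_eq_of_pderiv_eq_zero f.2 (congrArg Subtype.val h)
    exact ⟨c, Subtype.ext hc⟩

theorem mulForms_shortExact (m : ℕ) :
    (ShortComplex.mk (mulForms hu m) (evalForms hu (m + 1))
      (mulForms_comp_evalForms hu m)).ShortExact := by
  refine shortExact_of_rep (fun f h hfh => ?_) (fun z => ?_) (fun f h => ?_)
  · exact Subtype.ext (mul_left_cancel₀ (X_ne_zero 1) (congrArg Subtype.val hfh))
  · let f : homogeneousSubmodule (Fin 2) ℂ (m + 1) :=
      ⟨(z : ℂ) • X 0 ^ (m + 1), Submodule.smul_mem _ _ (isHomogeneous_X_pow 0 (m + 1))⟩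
    refine ⟨f, (evalForms_apply hu (m + 1) f).trans ?_⟩
    rw [smul_eval, map_pow, eval_X]
    exact (congrArg (fun t => (z : ℂ) * t) (one_pow _)).trans (mul_one _)
  · obtain ⟨r, hr, hrf⟩ := exists_X_mul_eq f.2 h
    exact ⟨(⟨r, hr⟩ : homogeneousSubmodule (Fin 2) ℂ m), Subtype.ext hrf⟩

end Sequences

end FiberedThreeManifold

theorem lemma4p1 {g p : ℕ} (hp : 1 ≤ p) (hgp : 2 < 2 * g + p)
    (φ : MulAut (FiberedThreeManifold.SurfaceGroup g p))
    (hφ : FiberedThreeManifold.IsSurfaceMonodromy φ)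
    (lam : ℂˣ) (u : FiberedThreeManifold.SurfaceH1 g p)
    (hu : (FiberedThreeManifold.pullback φ).HasEigenvector ((lam : ℂ) ^ 2) u)
    (n : ℕ) (hn : 3 < n)
    (hlam : ¬ (FiberedThreeManifold.pullback φ).HasEigenvalue ((lam : ℂ) ^ (n - 1)))
    (hlam_one : (lam : ℂ) ^ (n - 1) ≠ 1) (k : ℕ) :
    Nonempty
      (groupCohomology
          (FiberedThreeManifold.formsModule φ lam u hu.apply_eq_smul (n - 1)) k ≃ₗ[ℂ]
        groupCohomology
          (FiberedThreeManifold.formsModule φ lam u hu.apply_eq_smul (n - 3)) k) := by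
  obtain ⟨m, rfl⟩ : ∃ m, n = m + 3 := ⟨n - 3, by omega⟩
  have hne : (lam : ℂ) ^ (m + 2) ≠ 0 := pow_ne_zero _ lam.ne_zero
  -- The quotient in the second sequence has the inverse character, so the spectral hypothesis is
  -- transported by inversion symmetry.
  have hlam' : ¬ (FiberedThreeManifold.pullback φ).HasEigenvalue ((lam : ℂ) ^ (m + 2))⁻¹ :=
    fun h => hlam (by
      have := FiberedThreeManifold.hasEigenvalue_inv hp hφ (inv_ne_zero hne) h
      rwa [inv_inv] at this)
  obtain ⟨e₁⟩ := FiberedThreeManifold.nonempty_linearEquiv_of_isZero_left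
    (FiberedThreeManifold.derivForms_shortExact hu.apply_eq_smul (m + 1))
    (FiberedThreeManifold.isZero_groupCohomology_characterModule hp
      (fun γ => by
        rw [MonoidHom.pow_apply, FiberedThreeManifold.baseCharacter_incl, one_pow])
      (by rw [MonoidHom.pow_apply, FiberedThreeManifold.baseCharacter_stable,
        Units.val_pow_eq_pow_val]; rfl) hlam_one hlam) k
  obtain ⟨e₂⟩ := FiberedThreeManifold.nonempty_linearEquiv_of_isZero_right
    (FiberedThreeManifold.mulForms_shortExact hu.apply_eq_smul m)
    (FiberedThreeManifold.isZero_groupCohomology_characterModule hp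
      (fun γ => by
        rw [MonoidHom.pow_apply, MonoidHom.inv_apply, FiberedThreeManifold.baseCharacter_incl,
          inv_one, one_pow])
      (by rw [MonoidHom.pow_apply, MonoidHom.inv_apply, FiberedThreeManifold.baseCharacter_stable,
        Units.val_pow_eq_pow_val, Units.val_inv_eq_inv_val, inv_pow]; rfl)
      (fun h => hlam_one (inv_eq_one.1 h)) hlam') k
  exact ⟨e₁.trans e₂.symm⟩
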